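/- Let $L|K$ be a finite field extension and $v$ a (Krull) valuation on $L$, written additively, such that $v$ is (up to equivalence) the only extension of $v|_K$ from $K$ to $L$ (a "uv-extension"). Write $vK$, $vL$ for the value groups, $Kv$, $Lv$ for the residue fields, $\widetilde{vK}$ for the divisible hull of $vK$, and let $p$ be the characteristic exponent of $Kv$ (that is, $p=\operatorname{char}Kv$ if this is positive, and $p=1$ otherwise). For $a\in L$ put $v(a-K)=\{v(a-c)\mid c\in K\}$. Call $a$ weakly immediate over $K$ if $v(a-K)$ has no maximal element, and let $\operatorname{dist}(a,K)$ be the cut in $\widetilde{vK}$ whose lower cut set is the smallest initial segment of $\widetilde{vK}$ containing $v(a-K)\cap\widetilde{vK}$. For $\alpha\in\widetilde{vK}$, $\alpha+\operatorname{dist}(a,K)$ is the cut whose lower cut set is obtained by adding $\alpha$ to every element of the lower cut set of $\operatorname{dist}(a,K)$. Let $\operatorname{ndd}(L|K,v)$ be the minimal $k\ge 0$ for which there are elements $a_1,\dots,a_k\in L\setminus K$, all weakly immediate over $K$, such that for every $b\in L\setminus K$ that is weakly immediate over $K$ there are $i\in\{1,\dots,k\}$ and $\alpha\in vK$ with $\operatorname{dist}(b,K)=\alpha+\operatorname{dist}(a_i,K)$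 (and $\infty$ if no such $k$ exists). Let $\operatorname{ndd}^*(L|K,v)$ be defined in the same way with $\alpha\in\widetilde{vK}$ in place of $\alpha\in vK$. Proposition 3.4. Assume that $(L|K,v)$ is a finite uv-extension and that $L|K$ is a tower of extensions of degree $p$, i.e. there are intermediate fields $K=L_0\subseteq L_1\subseteq\dots\subseteq L_n=L$ with $[L_{i+1}:L_i]=p$ for all $i<n$. If the defect $$d(L|K,v)=\frac{[L:K]}{(vL:vK)\,[Lv:Kv]}$$ equals $p^m$ with $m\ge 0$, then $$\operatorname{ndd}(L|K,v)\le m\cdot(vL:vK)\quad\text{and}\quad \operatorname{ndd}^*(L|K,v)\le m .$$ In particular, both numbers are finite. -/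

import Mathlib

namespace ValuedExt

section OneField

variable {F Γ : Type*} [Field F] [AddCommGroup Γ] [LinearOrder Γ] [IsOrderedAddMonoid Γ]

/-- The value group `vF = v(F^×)` of an additively written Krull valuation
`v : F → Γ ∪ {∞}`, as a subgroup of `Γ`. -/
def valueGroup (v : AddValuation F (WithTop Γ)) : AddSubgroup Γ where
  carrier := {γ | ∃ x : F, v x = (γ : WithTop Γ)}
  zero_mem' := ⟨1, by simp⟩
  add_mem' := by
    rintro a b ⟨x, hx⟩ ⟨y, hy⟩
    exact ⟨x * y, by rw [v.map_mul, hx, hy, WithTop.coe_add]⟩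
  neg_mem' := by
    rintro a ⟨x, hx⟩
    have hx0 : x ≠ 0 := by
      rintro rfl
      rw [v.map_zero] at hx
      exact WithTop.coe_ne_top hx.symm
    refine ⟨x⁻¹, ?_⟩
    have h : v x⁻¹ + v x = 0 := by
      rw [← v.map_mul, inv_mul_cancel₀ hx0, v.map_one]
    rw [hx] at h
    cases hy : v x⁻¹ with
    | top => rw [hy, WithTop.top_add] at h; exact absurd h WithTop.top_ne_zero
    | coe b =>
      rw [hy] at h
      have h' : b + a = 0 := by exact_mod_cast h
      rw [eq_neg_of_add_eq_zero_left h']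

/-- The valuation ring `{x ∈ F ∣ v x ≥ 0}`. -/
def valuationRing (v : AddValuation F (WithTop Γ)) : ValuationSubring F where
  carrier := {x | 0 ≤ v x}
  zero_mem' := by simp
  one_mem' := by simp
  add_mem' := fun {_ _} hx hy => v.map_le_add hx hy
  mul_mem' := by
    intro x y hx hy
    change 0 ≤ v (x * y)
    rw [v.map_mul]
    exact add_nonneg hx hy
  neg_mem' := by
    intro x hx
    change 0 ≤ v (-x)
    rwa [v.map_neg]
  mem_or_inv_mem' := by
    intro x
    by_contra hcon
    rw [not_or] at hcon
    obtain ⟨h1, h2⟩ := hcon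
    have h1 : v x < 0 := not_le.mp h1
    have h2 : v x⁻¹ < 0 := not_le.mp h2
    have hx0 : x ≠ 0 := by
      rintro rfl
      simp at h1
    have h : v x⁻¹ + v x = 0 := by
      rw [← v.map_mul, inv_mul_cancel₀ hx0, v.map_one]
    exact absurd h (((add_le_add_right h1.le _).trans_eq (add_zero _)).trans_lt h2).ne

/-- The residue field `Fv`. -/
abbrev residueField (v : AddValuation F (WithTop Γ)) : Type _ :=
  IsLocalRing.ResidueField (valuationRing v)

end OneField

section Extension

/- A valued field extension `(L|K,v)` is given by a field extension `L|K` and a valuation `v` of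
`L`; the field `K` carries the restriction of `v`. -/
variable (K : Type*) {L Γ : Type*} [Field K] [Field L] [Algebra K L]
  [AddCommGroup Γ] [LinearOrder Γ] [IsOrderedAddMonoid Γ]

/-- The restriction of `v` to `K`. -/
abbrev restrict (v : AddValuation L (WithTop Γ)) : AddValuation K (WithTop Γ) :=
  v.comap (algebraMap K L)

/-- `(L|K,v)` is a uv-extension: `v` is the only extension of `v|_K` from `K` to `L`. As usual,
equivalent valuations are identified, so valuations of `L` are represented by their valuation
rings; a valuation with ring `B` extends `v|_K` if and only if `B ∩ K` is the valuation ring of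
`v|_K`. -/
def IsUV (v : AddValuation L (WithTop Γ)) : Prop :=
  ∀ B : ValuationSubring L,
    B.comap (algebraMap K L) = valuationRing (restrict K v) → B = valuationRing v

/-- The ramification index `(vL : vK)`. -/
noncomputable def ramificationIndex (v : AddValuation L (WithTop Γ)) : ℕ :=
  (valueGroup (restrict K v)).relIndex (valueGroup v)

/-- The inclusion of the valuation ring of `K` in the valuation ring of `L`. -/
def valuationRingMap (v : AddValuation L (WithTop Γ)) :
    valuationRing (restrict K v) →+* valuationRing v :=
  ((algebraMap K L).comp (valuationRing (restrict K v)).subtype).codRestrict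
    (valuationRing v).toSubring (fun x => x.2)

instance isLocalHom_valuationRingMap (v : AddValuation L (WithTop Γ)) :
    IsLocalHom (valuationRingMap K v) where
  map_nonunit := by
    intro a ha
    obtain ⟨b, hb⟩ := ha.exists_right_inv
    have hb' : algebraMap K L (a : K) * (b : L) = 1 := congrArg Subtype.val hb
    have ha0 : (a : K) ≠ 0 := by
      intro h
      rw [h, map_zero, zero_mul] at hb'
      exact zero_ne_one hb'
    have hinv : algebraMap K L (a : K)⁻¹ = (b : L) := by
      rw [map_inv₀]
      exact inv_eq_of_mul_eq_one_right hb'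
    have hmem : (a : K)⁻¹ ∈ valuationRing (restrict K v) := by
      change 0 ≤ v (algebraMap K L (a : K)⁻¹)
      rw [hinv]
      exact b.2
    exact IsUnit.of_mul_eq_one (⟨(a : K)⁻¹, hmem⟩ : valuationRing (restrict K v))
      (Subtype.ext (mul_inv_cancel₀ ha0))

/-- The induced embedding `Kv → Lv` of residue fields. -/
noncomputable def residueMap (v : AddValuation L (WithTop Γ)) :
    residueField (restrict K v) →+* residueField v :=
  IsLocalRing.ResidueField.map (valuationRingMap K v)

/-- The inertia degree `[Lv : Kv]`. -/
noncomputable def inertiaDegree (v : AddValuation L (WithTop Γ)) : ℕ :=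
  letI := (residueMap K v).toAlgebra
  Module.finrank (residueField (restrict K v)) (residueField v)

/-- The defect `d(L|K,v) = [L:K] / ((vL:vK) [Lv:Kv])` of a finite uv-extension. -/
noncomputable def defect (v : AddValuation L (WithTop Γ)) : ℚ :=
  (Module.finrank K L : ℚ) / ((ramificationIndex K v : ℚ) * (inertiaDegree K v : ℚ))

variable (L) in
/-- `L|K` is a tower `K = E 0 ⊆ E 1 ⊆ ⋯ ⊆ E n = L` of extensions of degree `p`. -/
def IsTowerOfDegree (p : ℕ) : Prop :=
  ∃ (n : ℕ) (E : ℕ → IntermediateField K L), E 0 = ⊥ ∧ E n = ⊤ ∧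
    ∀ i < n, E i ≤ E (i + 1) ∧ IntermediateField.relfinrank (E i) (E (i + 1)) = p

/-- The set `v(a - K) = {v(a - c) ∣ c ∈ K}`. -/
def valuesOfDifferences (v : AddValuation L (WithTop Γ)) (a : L) : Set (WithTop Γ) :=
  Set.range fun c : K => v (a - algebraMap K L c)

/-- `a` is weakly immediate over `K`: the set `v(a - K)` has no maximal element. -/
def IsWeaklyImmediate (v : AddValuation L (WithTop Γ)) (a : L) : Prop :=
  ¬ ∃ γ, IsGreatest (valuesOfDifferences K v a) γ

/-- The divisible hull of `vK`. -/
abbrev DivHull (v : AddValuation L (WithTop Γ)) : Type _ :=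
  DivisibleHull (valueGroup (restrict K v))

/-- An element `γ ∈ Γ` some positive multiple `n γ` of which lies in `vK` is identified with the
element `(n γ) / n` of the divisible hull of `vK`; this is the relation that `q` is that
element. -/
def Represents (v : AddValuation L (WithTop Γ)) (q : DivHull K v) (γ : Γ) : Prop :=
  ∃ (n : ℕ+) (α : valueGroup (restrict K v)),
    (α : Γ) = (n : ℕ) • γ ∧ q = DivisibleHull.mk α n

/-- The distance `dist(a,K)`: the cut in the divisible hull of `vK` whose lower cut set is the
smallest initial segment containing the intersection of `v(a - K)` with the divisible hull of
`vK`. A cut is represented by its lower cut set. -/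
def dist (v : AddValuation L (WithTop Γ)) (a : L) : LowerSet (DivHull K v) :=
  lowerClosure {q | ∃ γ : Γ, (γ : WithTop Γ) ∈ valuesOfDifferences K v a ∧ Represents K v q γ}

open scoped Pointwise in
/-- `m` elements of `L \ K` that are weakly immediate over `K` suffice to represent, up to shifts
by elements of `H`, the distances of all elements of `L \ K` that are weakly immediate
over `K`. -/
def DistancesRepresentedBy (v : AddValuation L (WithTop Γ)) (H : AddSubgroup (DivHull K v))
    (m : ℕ) : Prop :=
  ∃ a : Fin m → L,
    (∀ i, a i ∉ Set.range (algebraMap K L) ∧ IsWeaklyImmediate K v (a i)) ∧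
    ∀ b : L, b ∉ Set.range (algebraMap K L) → IsWeaklyImmediate K v b →
      ∃ i, ∃ α ∈ H, dist K v b = α +ᵥ dist K v (a i)

/-- The number of distances in `(L|K,v)` that are distinct modulo the subgroup `H` of the
divisible hull of `vK`: the minimal number of representatives, and `⊤` if there is no finite
system of representatives. -/
noncomputable def numDistances (v : AddValuation L (WithTop Γ)) (H : AddSubgroup (DivHull K v)) :
    ℕ∞ :=
  ⨅ (m : ℕ) (_ : DistancesRepresentedBy K v H m), (m : ℕ∞)

/-- `ndd(L|K,v)`, the number of distances that are distinct modulo `vK`. -/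
noncomputable def ndd (v : AddValuation L (WithTop Γ)) : ℕ∞ :=
  numDistances K v (DivisibleHull.coeAddMonoidHom (valueGroup (restrict K v))).range

/-- `ndd*(L|K,v)`, the number of distances that are distinct modulo the divisible hull
of `vK`. -/
noncomputable def nddStar (v : AddValuation L (WithTop Γ)) : ℕ∞ :=
  numDistances K v ⊤

end Extension

end ValuedExt

namespace ValuedExt

open Polynomial

/-! ### Descending an approximation from a residue field -/

section Coarsening

/-! Each distance is attributed to one step `E ⊆ E'` of the tower. Let `b ∈ E'` be weakly immediate
over `K`. If some `y ∈ E` is closer to `b` than every element of `K`, then `b` and `y` have the same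
distance from `K`, and `y` lives lower in the tower. Otherwise, if `b ∉ E`, then `b` belongs to
`layerElements v E E'`, so it has no best approximation in `E`.

For prime `p`, a layer containing such an `a` is immediate, and its distances agree up to shifts by
`vE`. Indeed `E' = E(a)`, and for `f` of degree below `p` the linear Taylor term dominates: `f(a) -
f(c)` has the value of `f'(a)(a - c)`, and this beats the value of `f(a)` once `c` is close to `a`
(`eventually_valuation_aeval_sub`). So the layer costs one representative modulo the divisible hull
and at most `(vE : vK)` modulo `vK`. Being immediate, it contributes a full factor `p` to the
defect, while the fundamental inequality bounds every other layer. If `t` layers are nonempty, then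
`p ^ t * e * f ≤ [L:K] = p ^ m * e * f`, whence `t ≤ m`.

The hard point is to exclude that `f(a)` is at least as small as all `f'(a)(a - c)`. In that case
Newton iteration squares the approximation error, so the errors define a coarsening of the
valuation. By uniqueness of the extension, minimal polynomials of integral elements are integral,
and that of `a` reduces to a `p`-th power of a linear polynomial. As `a` also reduces to a root of
lower degree, its residue comes from `E`, which yields an impossibly good approximation
(`not_forall_valuation_aeval_le`). -/

theorem mem_range_of_map_eq_X_sub_C_pow {k E : Type*} [Field k] [Field E] [Algebra k E] {x : E}
    {p : ℕ} {f g : k[X]} (hf : f ≠ 0) (hfx : aeval x f = 0) (hfp : f.natDegree < p)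
    (hg : g.map (algebraMap k E) = (X - C x) ^ p) (hp : ∀ j : ℕ, 0 < j → j < p → (j : k) ≠ 0) :
    x ∈ (algebraMap k E).range := by
  have hint : IsIntegral k x := IsAlgebraic.isIntegral ⟨f, hf, hfx⟩
  have hgx : aeval x g = 0 := by
    rw [aeval_def, ← eval_map, hg]
    have : p ≠ 0 := by omega
    simp [this]
  have hdvd : (minpoly k x).map (algebraMap k E) ∣ (X - C x) ^ p := by
    rw [← hg]; exact Polynomial.map_dvd _ (minpoly.dvd k x hgx)
  obtain ⟨j, -, hj⟩ := (dvd_prime_pow (prime_X_sub_C x) p).1 hdvd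
  have hmon : ((minpoly k x).map (algebraMap k E)).Monic := (minpoly.monic hint).map _
  have heq := eq_of_monic_of_associated hmon ((monic_X_sub_C x).pow j) hj
  have hdeg : (minpoly k x).natDegree = j := by
    have := congrArg natDegree heq
    simpa using this
  have hj0 : 0 < j := hdeg ▸ minpoly.natDegree_pos hint
  have hjp : j < p := by
    have := natDegree_le_of_dvd (minpoly.dvd k x hfx) hf
    omega
  -- The minimal polynomial is `(X - x) ^ j` with `0 < j < p`. Its second coefficient `-j x` lies in
  -- `k`, where `j` is invertible.
  have hnext := congrArg nextCoeff heq
  rw [nextCoeff_map (algebraMap k E).injective, (monic_X_sub_C x).nextCoeff_pow,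
    nextCoeff_X_sub_C] at hnext
  have hjk := hp j hj0 hjp
  have hjE : (j : E) ≠ 0 := by
    have := (_root_.map_ne_zero (algebraMap k E)).2 hjk
    simpa using this
  refine ⟨-((minpoly k x).nextCoeff / j), ?_⟩
  rw [map_neg, map_div₀, hnext, map_natCast, nsmul_eq_mul]
  field_simp

variable {F L : Type*} [Field F] [Field L] [Algebra F L]

/-- The inclusion of the valuation ring `B ∩ F` in the valuation ring `B`. -/
def comapMap (B : ValuationSubring L) : B.comap (algebraMap F L) →+* B :=
  ((algebraMap F L).comp (B.comap (algebraMap F L)).subtype).codRestrict B.toSubring fun x => x.2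

instance isLocalHom_comapMap (B : ValuationSubring L) : IsLocalHom (comapMap (F := F) B) where
  map_nonunit := by
    intro a ha
    obtain ⟨b, hb⟩ := ha.exists_right_inv
    have hb' : algebraMap F L (a : F) * (b : L) = 1 := congrArg Subtype.val hb
    have ha0 : (a : F) ≠ 0 := by
      intro h
      rw [h, map_zero, zero_mul] at hb'
      exact zero_ne_one hb'
    have hmem : (a : F)⁻¹ ∈ B.comap (algebraMap F L) := by
      rw [ValuationSubring.mem_comap, map_inv₀, inv_eq_of_mul_eq_one_right hb']
      exact b.2
    exact IsUnit.of_mul_eq_one (⟨(a : F)⁻¹, hmem⟩ : B.comap (algebraMap F L))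
      (Subtype.ext (mul_inv_cancel₀ ha0))

theorem residue_eq_zero_iff_valuation_lt_one (B : ValuationSubring L) (x : B) :
    IsLocalRing.residue B x = 0 ↔ B.valuation x < 1 := by
  rw [IsLocalRing.residue_eq_zero_iff, B.valuation_lt_one_iff]

/-- Reduce modulo the maximal ideal of `B`: the residue of `a` is a root of the nonzero reduction of
`f`, and `g` reduces to the `p`-th power of `X` minus that residue. The residue therefore comes from
`F`, and `c` is a lift. -/
theorem exists_valuation_sub_lt_one (B : ValuationSubring L) {a : L} (ha : a ∈ B) {p : ℕ}
    {f g : F[X]} (hfB : ∀ i, algebraMap F L (f.coeff i) ∈ B)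
    (hf1 : ∃ i, B.valuation (algebraMap F L (f.coeff i)) = 1)
    (hfa : B.valuation (aeval a f) < 1) (hfp : f.natDegree < p)
    (hg : ∀ i, B.valuation (algebraMap F L (g.coeff i) - ((X - C a) ^ p : L[X]).coeff i) < 1)
    (hp : ∀ j : ℕ, 0 < j → j < p → B.valuation (j : L) = 1) :
    ∃ c : F, B.valuation (a - algebraMap F L c) < 1 := by
  set O := B.comap (algebraMap F L)
  let _ : Algebra (IsLocalRing.ResidueField O) (IsLocalRing.ResidueField B) :=
    (IsLocalRing.ResidueField.map (comapMap (F := F) B)).toAlgebra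
  set ρ := IsLocalRing.residue B
  set ρ₀ := IsLocalRing.residue O
  have hcomm : (algebraMap (IsLocalRing.ResidueField O) (IsLocalRing.ResidueField B)).comp ρ₀ =
      ρ.comp (comapMap (F := F) B) := by
    ext x; rfl
  have hsub : ((algebraMap F L).comp O.subtype) = B.subtype.comp (comapMap (F := F) B) := rfl
  let aB : B := ⟨a, ha⟩
  obtain ⟨f₀, hf₀⟩ : ∃ f₀ : O[X], f₀.map O.subtype = f := by
    refine (Polynomial.mem_lifts f).1 ((lifts_iff_coeff_lifts f).2 fun i => ?_)
    exact ⟨⟨f.coeff i, hfB i⟩, rfl⟩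
  have hpowB : ((X - C aB : B[X]) ^ p).map B.subtype = (X - C a) ^ p := by
    simp [aB]
  have hgB : ∀ i, algebraMap F L (g.coeff i) ∈ B := by
    intro i
    have h1 := B.mem_of_valuation_le_one _ (hg i).le
    have h2 : ((X - C a) ^ p : L[X]).coeff i ∈ B := by
      rw [← hpowB, coeff_map]; exact Subtype.property _
    simpa using add_mem h1 h2
  obtain ⟨g₀, hg₀⟩ : ∃ g₀ : O[X], g₀.map O.subtype = g := by
    refine (Polynomial.mem_lifts g).1 ((lifts_iff_coeff_lifts g).2 fun i => ?_)
    exact ⟨⟨g.coeff i, hgB i⟩, rfl⟩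
  have key := mem_range_of_map_eq_X_sub_C_pow (k := IsLocalRing.ResidueField O)
    (E := IsLocalRing.ResidueField B) (x := ρ aB) (p := p) (f := f₀.map ρ₀) (g := g₀.map ρ₀)
    ?_ ?_ ?_ ?_ ?_
  · obtain ⟨y, hy⟩ := key
    obtain ⟨c, rfl⟩ := IsLocalRing.residue_surjective y
    refine ⟨c, ?_⟩
    have : ρ (aB - comapMap B c) = 0 := by
      rw [map_sub, sub_eq_zero, ← hy]; rfl
    exact (residue_eq_zero_iff_valuation_lt_one B _).1 this
  · obtain ⟨i, hi⟩ := hf1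
    intro h0
    have h1 := congrArg (fun q => (algebraMap (IsLocalRing.ResidueField O)
      (IsLocalRing.ResidueField B)) (q.coeff i)) h0
    simp only [coeff_map, coeff_zero, map_zero] at h1
    have h2 : ρ (comapMap B (f₀.coeff i)) = 0 := h1
    rw [residue_eq_zero_iff_valuation_lt_one] at h2
    rw [← hf₀, coeff_map] at hi
    exact h2.ne hi
  · have h2 : ρ (eval₂ (comapMap (F := F) B) aB f₀) = 0 := by
      rw [residue_eq_zero_iff_valuation_lt_one]
      have : ((eval₂ (comapMap (F := F) B) aB f₀ : B) : L) = aeval a f := by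
        rw [← hf₀, aeval_def, eval₂_map, hsub]
        exact hom_eval₂ f₀ (comapMap (F := F) B) B.subtype aB
      rwa [this]
    rw [aeval_def, eval₂_map, hcomm, ← hom_eval₂, h2]
  · refine (natDegree_map_le).trans_lt ?_
    rwa [← natDegree_map_eq_of_injective (f := O.subtype) Subtype.val_injective f₀, hf₀]
  · rw [Polynomial.map_map, hcomm, ← Polynomial.map_map]
    have : (X - C (ρ aB) : (IsLocalRing.ResidueField B)[X]) ^ p
        = ((X - C aB : B[X]) ^ p).map ρ := by simp
    rw [this]
    ext i
    rw [coeff_map, coeff_map, coeff_map, ← sub_eq_zero, ← map_sub, residue_eq_zero_iff_valuation_lt_one]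
    have h1 := hg i
    rw [← hpowB, ← hg₀, coeff_map, coeff_map] at h1
    exact h1
  · intro j hj hjp h0
    have h1 : ρ (j : B) = 0 := by
      have := congrArg (algebraMap (IsLocalRing.ResidueField O) (IsLocalRing.ResidueField B)) h0
      simpa using this
    rw [residue_eq_zero_iff_valuation_lt_one] at h1
    exact h1.ne (by simpa using hp j hj hjp)

end Coarsening

/-! ### Newton approximation and the coarsening it produces -/

section Newton

variable {F L Γ₀ : Type*} [Field F] [Field L] [Algebra F L] [LinearOrderedCommGroupWithZero Γ₀]

/-- The coarsening of the valuation ring of `w` with respect to a set `S` of values which is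
cofinal in the positive part of a convex subgroup. -/
def coarsening (w : Valuation L Γ₀) (S : Set Γ₀) (h1 : ∃ s ∈ S, s ≤ 1)
    (hmul : ∀ s ∈ S, ∀ t ∈ S, ∃ r ∈ S, r ≤ s * t) : ValuationSubring L where
  carrier := {x | ∃ s ∈ S, w x * s ≤ 1}
  zero_mem' := by
    obtain ⟨s, hs, -⟩ := h1
    exact ⟨s, hs, by simp⟩
  one_mem' := by
    obtain ⟨s, hs, h⟩ := h1
    exact ⟨s, hs, by simpa⟩
  neg_mem' := by
    rintro x ⟨s, hs, h⟩
    exact ⟨s, hs, by rwa [Valuation.map_neg]⟩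
  mul_mem' := by
    rintro x y ⟨s, hs, hxs⟩ ⟨t, ht, hyt⟩
    obtain ⟨r, hr, hrst⟩ := hmul s hs t ht
    refine ⟨r, hr, ?_⟩
    calc w (x * y) * r ≤ w (x * y) * (s * t) := by gcongr
      _ = (w x * s) * (w y * t) := by rw [map_mul, mul_mul_mul_comm]
      _ ≤ 1 := mul_le_one' hxs hyt
  add_mem' := by
    have aux : ∀ x y : L, ∀ s ∈ S, ∀ t ∈ S, s ≤ t → w x * s ≤ 1 → w y * t ≤ 1 →
        w (x + y) * s ≤ 1 := by
      intro x y s _ t _ hst hx hy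
      rcases le_max_iff.1 (w.map_add x y) with h | h
      · exact (mul_le_mul_left h s).trans hx
      · exact (mul_le_mul' h hst).trans hy
    rintro x y ⟨s, hs, hxs⟩ ⟨t, ht, hyt⟩
    rcases le_total s t with h | h
    · exact ⟨s, hs, aux x y s hs t ht h hxs hyt⟩
    · exact ⟨t, ht, add_comm x y ▸ aux y x t ht s hs h hyt hxs⟩
  mem_or_inv_mem' := by
    obtain ⟨s, hs, h⟩ := h1
    intro x
    rcases le_total (w x) 1 with hx | hx
    · exact .inl ⟨s, hs, mul_le_one' hx h⟩
    · refine .inr ⟨s, hs, mul_le_one' ?_ h⟩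
      rw [map_inv₀]
      exact inv_le_one_of_one_le₀ hx

/-- The nonunits are `0` and the inverses of nonmembers; `h0` is what settles `x = 0`. -/
theorem valuation_coarsening_lt_one_iff (w : Valuation L Γ₀) (S : Set Γ₀) (h1 : ∃ s ∈ S, s ≤ 1)
    (hmul : ∀ s ∈ S, ∀ t ∈ S, ∃ r ∈ S, r ≤ s * t) (h0 : ∀ s ∈ S, 0 < s) (x : L) :
    (coarsening w S h1 hmul).valuation x < 1 ↔ ∀ s ∈ S, w x < s := by
  rw [← ValuationSubring.mem_nonunits_iff, ← inv_inv x, ValuationSubring.inv_mem_nonunits_iff,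
    inv_inv]
  change x⁻¹ = 0 ∨ ¬ (∃ s ∈ S, w x⁻¹ * s ≤ 1) ↔ _
  rcases eq_or_ne x 0 with rfl | hx
  · simpa using h0
  · have hwx : 0 < w x := (Valuation.pos_iff w).2 hx
    simp only [inv_eq_zero, hx, false_or, not_exists, not_and, not_le, map_inv₀]
    refine forall₂_congr fun s _ => ?_
    rw [← div_eq_inv_mul, one_lt_div₀ hwx]

theorem valuation_coarsening_eq_one (w : Valuation L Γ₀) (S : Set Γ₀) (h1 : ∃ s ∈ S, s ≤ 1)
    (hmul : ∀ s ∈ S, ∀ t ∈ S, ∃ r ∈ S, r ≤ s * t) {x : L} (hx : w x = 1) :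
    (coarsening w S h1 hmul).valuation x = 1 := by
  obtain ⟨s, hs, h⟩ := id h1
  have h2 : (coarsening w S h1 hmul).valuation x ≤ 1 :=
    (ValuationSubring.valuation_le_one_iff _ _).2 ⟨s, hs, by rwa [hx, one_mul]⟩
  have h3 : (coarsening w S h1 hmul).valuation x⁻¹ ≤ 1 :=
    (ValuationSubring.valuation_le_one_iff _ _).2 ⟨s, hs, by rwa [map_inv₀, hx, inv_one, one_mul]⟩
  have hx0 : x ≠ 0 := by
    rintro rfl
    simp at hx
  refine le_antisymm h2 ?_
  rw [map_inv₀] at h3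
  exact (inv_le_one₀ ((Valuation.pos_iff _).2 hx0)).1 h3

theorem mem_coarsening (w : Valuation L Γ₀) (S : Set Γ₀) (h1 : ∃ s ∈ S, s ≤ 1)
    (hmul : ∀ s ∈ S, ∀ t ∈ S, ∃ r ∈ S, r ≤ s * t) {x : L} (hx : w x ≤ 1) :
    x ∈ coarsening w S h1 hmul := by
  obtain ⟨s, hs, h⟩ := id h1
  exact ⟨s, hs, mul_le_one' hx h⟩

variable (F) in
/-- The element `b` has no best approximation by elements of `F`. -/
def NoBestApproximation (w : Valuation L Γ₀) (b : L) : Prop :=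
  ∀ c : F, ∃ c' : F, w (b - algebraMap F L c') < w (b - algebraMap F L c)

variable (F) in
/-- The minimal polynomials over `F` of integral elements have integral coefficients. -/
def MinpolyIntegral (w : Valuation L Γ₀) : Prop :=
  ∀ x, w x ≤ 1 → ∀ i, w (algebraMap F L ((minpoly F x).coeff i)) ≤ 1

/-- Two approximations of different quality differ by an element of `F` carrying the value of the
worse one. This permits normalising `b - c` by a factor from `F`. -/
theorem NoBestApproximation.exists_eq {w : Valuation L Γ₀} {b : L}
    (hb : NoBestApproximation F w b) (c : F) :
    ∃ d : F, d ≠ 0 ∧ w (algebraMap F L d) = w (b - algebraMap F L c) := by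
  obtain ⟨c', hc'⟩ := hb c
  have h : w (algebraMap F L (c' - c)) = w (b - algebraMap F L c) := by
    have : algebraMap F L (c' - c) = (b - algebraMap F L c) - (b - algebraMap F L c') := by
      rw [map_sub]; ring
    rw [this, Valuation.map_sub_eq_of_lt_left w hc']
  refine ⟨c' - c, ?_, h⟩
  intro h0
  rw [h0, map_zero, map_zero] at h
  exact not_lt_zero (h ▸ hc')

theorem natDegree_minpoly_le_of_affine {y : L} (hy : IsIntegral F y) {c d : F} (hd : d ≠ 0) :
    (minpoly F y).natDegree ≤
      (minpoly F (algebraMap F L d * y + algebraMap F L c)).natDegree := by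
  set a := algebraMap F L d * y + algebraMap F L c with ha
  have hai : IsIntegral F a := (isIntegral_algebraMap.mul hy).add isIntegral_algebraMap
  have hne : (C d * X + C c : F[X]).natDegree = 1 := natDegree_linear hd
  have h0 : (minpoly F a).comp (C d * X + C c) ≠ 0 := by
    intro h
    have := congrArg natDegree h
    rw [natDegree_comp, hne, natDegree_zero, mul_one] at this
    exact (minpoly.natDegree_pos hai).ne' this
  have h1 : aeval y ((minpoly F a).comp (C d * X + C c)) = 0 := by
    rw [aeval_comp]
    have : aeval y (C d * X + C c : F[X]) = a := by simp [ha]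
    rw [this, minpoly.aeval]
  have := natDegree_le_of_dvd (minpoly.dvd F y h1) h0
  rwa [natDegree_comp, hne, mul_one] at this

theorem natDegree_minpoly_affine {y : L} (hy : IsIntegral F y) {c d : F} (hd : d ≠ 0) :
    (minpoly F (algebraMap F L d * y + algebraMap F L c)).natDegree =
      (minpoly F y).natDegree := by
  have hdL : algebraMap F L d ≠ 0 := (_root_.map_ne_zero _).2 hd
  refine le_antisymm ?_ (natDegree_minpoly_le_of_affine hy hd)
  have := natDegree_minpoly_le_of_affine (c := -(c / d))
    ((isIntegral_algebraMap.mul hy).add isIntegral_algebraMap :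
      IsIntegral F (algebraMap F L d * y + algebraMap F L c)) (inv_ne_zero hd)
  have hy' : algebraMap F L d⁻¹ * (algebraMap F L d * y + algebraMap F L c) +
      algebraMap F L (-(c / d)) = y := by
    rw [map_inv₀, map_neg, map_div₀]
    field_simp
    ring
  rwa [hy'] at this

/-- The element `y = (a - c) / d` is integral, and the minimal polynomial of `a` arises from that of
`y` by scaling the roots by `d` and translating by `c`. Modulo `d` the scaling leaves only the
leading power, and `c` becomes `a`. -/
theorem minpoly_coeff_sub_pow_le [FiniteDimensional F L] {w : Valuation L Γ₀}
    (hint : MinpolyIntegral F w) {a : L} (ha : w a ≤ 1) {c d : F} (hd : d ≠ 0)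
    (hd1 : w (algebraMap F L d) ≤ 1) (hcd : w (a - algebraMap F L c) ≤ w (algebraMap F L d))
    (i : ℕ) :
    w (algebraMap F L ((minpoly F a).coeff i) -
      ((X - C a) ^ (minpoly F a).natDegree : L[X]).coeff i) ≤ w (algebraMap F L d) := by
  have hai : IsIntegral F a := Algebra.IsIntegral.isIntegral a
  have hdL : algebraMap F L d ≠ 0 := (_root_.map_ne_zero _).2 hd
  set y : L := (a - algebraMap F L c) / algebraMap F L d with hy
  have hyi : IsIntegral F y := Algebra.IsIntegral.isIntegral y
  have hy1 : w y ≤ 1 := by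
    rw [hy, map_div₀]
    exact div_le_one_of_le₀ hcd zero_le
  have hady : algebraMap F L d * y = a - algebraMap F L c := by rw [hy]; field_simp
  set q := minpoly F y with hq
  have hqm : q.Monic := minpoly.monic hyi
  set G : F[X] := (q.scaleRoots d).comp (X - C c) with hG
  have hGm : G.Monic := by
    refine Monic.comp ((monic_scaleRoots_iff d).2 hqm) (monic_X_sub_C c) (by simp)
  have hGa : aeval a G = 0 := by
    rw [hG, aeval_comp]
    have : aeval a (X - C c : F[X]) = algebraMap F L d * y := by simp [hady]
    rw [this]
    exact scaleRoots_aeval_eq_zero (minpoly.aeval F y)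
  have hGdeg : G.natDegree = q.natDegree := by simp [hG, natDegree_comp]
  have hle : q.natDegree ≤ (minpoly F a).natDegree := by
    have := natDegree_minpoly_le_of_affine (c := c) hyi hd
    rwa [hady, sub_add_cancel] at this
  have hGeq : G = minpoly F a :=
    (eq_of_monic_of_dvd_of_natDegree_le (minpoly.monic hai) hGm (minpoly.dvd F a hGa)
      (hGdeg.trans_le hle))
  set O := w.valuationSubring
  have hc1 : w (algebraMap F L c) ≤ 1 := by
    have : algebraMap F L c = a - (a - algebraMap F L c) := by ring
    rw [this]
    exact (w.map_sub _ _).trans (max_le ha (hcd.trans hd1))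
  let d₀ : O := ⟨algebraMap F L d, hd1⟩
  let c₀ : O := ⟨algebraMap F L c, hc1⟩
  let a₀ : O := ⟨a, ha⟩
  obtain ⟨q₀, hq₀, -, hq₀m⟩ := lifts_and_natDegree_eq_and_monic (f := O.subtype)
    (p := q.map (algebraMap F L)) ((lifts_iff_coeff_lifts _).2 fun i =>
      ⟨⟨_, hint y hy1 i⟩, by rw [coeff_map]; rfl⟩) (hqm.map _)
  have hq₀deg : q₀.natDegree = q.natDegree := by
    rw [← natDegree_map_eq_of_injective (f := O.subtype) Subtype.val_injective q₀, hq₀,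
      natDegree_map]
  set G₀ : O[X] := (q₀.scaleRoots d₀).comp (X - C c₀) with hG₀
  have hG₀map : G₀.map O.subtype = (minpoly F a).map (algebraMap F L) := by
    rw [← hGeq, hG₀, hG, Polynomial.map_comp, Polynomial.map_comp, map_scaleRoots, map_scaleRoots,
      hq₀]
    · simp; rfl
    · simp [hqm.leadingCoeff]
    · simp [hq₀m.leadingCoeff]
  let π := Ideal.Quotient.mk (Ideal.span {d₀})
  have hπd : π d₀ = 0 := Ideal.Quotient.eq_zero_iff_mem.2 (Ideal.mem_span_singleton_self d₀)
  have hπc : π c₀ = π a₀ := by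
    rw [eq_comm, ← sub_eq_zero, ← map_sub]
    refine Ideal.Quotient.eq_zero_iff_mem.2 (Ideal.mem_span_singleton'.2 ⟨⟨y, hy1⟩, ?_⟩)
    refine Subtype.ext ?_
    change y * algebraMap F L d = a - algebraMap F L c
    rw [mul_comm, hady]
  have hpi : G₀.map π = ((X - C a₀) ^ q.natDegree : O[X]).map π := by
    have h1 : (q₀.scaleRoots d₀).map π = (X ^ q.natDegree : O[X]).map π := by
      ext i
      rw [coeff_map, coeff_map, coeff_scaleRoots, hq₀deg, coeff_X_pow]
      rcases lt_trichotomy i q.natDegree with h | h | h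
      · rw [map_mul, map_pow, hπd, zero_pow (by omega), mul_zero, if_neg h.ne, map_zero]
      · rw [h, ← hq₀deg, ← leadingCoeff, hq₀m.leadingCoeff]; simp
      · rw [coeff_eq_zero_of_natDegree_lt (by omega), if_neg h.ne']; simp
    rw [hG₀, Polynomial.map_comp, h1]
    simp [hπc]
  have hcoef := congrArg (fun r => r.coeff i) hpi
  simp only [coeff_map] at hcoef
  rw [← sub_eq_zero, ← map_sub, Ideal.Quotient.eq_zero_iff_mem, Ideal.mem_span_singleton'] at hcoef
  obtain ⟨z, hz⟩ := hcoef
  have h2 : algebraMap F L ((minpoly F a).coeff i) = ((G₀.coeff i : O) : L) := by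
    rw [← coeff_map, ← hG₀map, coeff_map]; rfl
  have h3 : ((X - C a) ^ (minpoly F a).natDegree : L[X]).coeff i =
      ((((X - C a₀) ^ q.natDegree : O[X]).coeff i : O) : L) := by
    have : ((X - C a) ^ (minpoly F a).natDegree : L[X])
        = ((X - C a₀) ^ q.natDegree : O[X]).map O.subtype := by
      rw [← hGeq, hGdeg]; simp; rfl
    rw [this, coeff_map]; rfl
  have h4 : ((z * d₀ : O) : L) = (z : L) * algebraMap F L d := rfl
  have h5 : (((G₀.coeff i - ((X - C a₀) ^ q.natDegree : O[X]).coeff i : O)) : L) =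
    ((G₀.coeff i : O) : L) - ((((X - C a₀) ^ q.natDegree : O[X]).coeff i : O) : L) := rfl
  rw [h2, h3, ← h5, ← hz, h4, map_mul]
  exact mul_le_of_le_one_left' z.2

/-- One step of Newton approximation. -/
theorem exists_valuation_sub_le_sq {w : Valuation L Γ₀} {a : L} (ha : w a ≤ 1)
    (hlim : NoBestApproximation F w a) {f : F[X]}
    (hf : ∀ i, w (algebraMap F L (f.coeff i)) ≤ 1)
    (hf1 : ∀ c : F, w (algebraMap F L c) ≤ 1 → w (algebraMap F L (f.derivative.eval c)) = 1)
    (hfa : ∀ c : F, w (aeval a f) ≤ w (a - algebraMap F L c)) (c : F)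
    (hc : w (a - algebraMap F L c) ≤ 1) :
    ∃ c' : F, w (a - algebraMap F L c') ≤ w (a - algebraMap F L c) ^ 2 := by
  set O := w.valuationSubring
  have hc1 : w (algebraMap F L c) ≤ 1 := by
    have : algebraMap F L c = a - (a - algebraMap F L c) := by ring
    rw [this]
    exact (w.map_sub _ _).trans (max_le ha hc)
  have hder := hf1 c hc1
  obtain ⟨f₀, hf₀⟩ : ∃ f₀ : O[X], f₀.map O.subtype = f.map (algebraMap F L) :=
    (Polynomial.mem_lifts _).1 ((lifts_iff_coeff_lifts _).2 fun i =>
      ⟨⟨_, hf i⟩, by rw [coeff_map]; rfl⟩)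
  let x : O := ⟨algebraMap F L c, hc1⟩
  let y : O := ⟨a - algebraMap F L c, hc⟩
  obtain ⟨k, hk⟩ := binomExpansion f₀ x y
  have heval : ∀ (g : F[X]) (g₀ : O[X]) (z : O), g₀.map O.subtype = g.map (algebraMap F L) →
      ((g₀.eval z : O) : L) = aeval (z : L) g := by
    intro g g₀ z h
    rw [aeval_def, ← eval_map, ← h, eval_map]
    exact (eval₂_at_apply O.subtype z).symm
  have hk' := congrArg (Subtype.val : O → L) hk
  have e1 : ((f₀.eval (x + y) : O) : L) = aeval a f := by
    rw [heval f f₀ _ hf₀]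
    congr 1
    congr 1
    change algebraMap F L c + (a - algebraMap F L c) = a
    ring
  have e2 : ((f₀.eval x : O) : L) = algebraMap F L (f.eval c) := by
    rw [heval f f₀ _ hf₀]
    exact aeval_algebraMap_apply_eq_algebraMap_eval c f
  have e3 : ((f₀.derivative.eval x : O) : L) = algebraMap F L (f.derivative.eval c) := by
    rw [heval f.derivative f₀.derivative _ (by rw [← derivative_map, hf₀, derivative_map])]
    exact aeval_algebraMap_apply_eq_algebraMap_eval c f.derivative
  have e4 : ((f₀.eval x + f₀.derivative.eval x * y + k * y ^ 2 : O) : L) =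
      ((f₀.eval x : O) : L) + ((f₀.derivative.eval x : O) : L) * (a - algebraMap F L c) +
        (k : L) * (a - algebraMap F L c) ^ 2 := rfl
  rw [e1, e4, e2, e3] at hk'
  have hder0 : algebraMap F L (f.derivative.eval c) ≠ 0 := by
    intro h
    rw [h, map_zero] at hder
    exact zero_ne_one hder
  refine ⟨c - f.eval c / f.derivative.eval c, ?_⟩
  set c' := c - f.eval c / f.derivative.eval c
  -- For the Newton iterate `c'`, the constant and linear Taylor terms at `c` combine to `f'(c) (a -
  -- c')`, and `f'(c)` is a unit.
  have hmul : algebraMap F L (f.derivative.eval c) * (a - algebraMap F L c') =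
      aeval a f - (k : L) * (a - algebraMap F L c) ^ 2 := by
    rw [hk']
    simp only [c', map_sub, map_div₀]
    field_simp
    ring
  have hval : w (a - algebraMap F L c') =
      w (aeval a f - (k : L) * (a - algebraMap F L c) ^ 2) := by
    rw [← hmul, map_mul, hder, one_mul]
  rcases le_max_iff.1 (w.map_sub (aeval a f) ((k : L) * (a - algebraMap F L c) ^ 2)) with h | h
  -- If `f(a)` were the dominant term, an approximation better than `c'` would violate `hfa`.
  · obtain ⟨c'', hc''⟩ := hlim c'
    rw [hval] at hc''
    exact absurd (hfa c'') (not_le.2 (hc''.trans_le h))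
  · rw [hval]
    refine h.trans ?_
    rw [map_mul, map_pow]
    exact mul_le_of_le_one_left' k.2

/-- Otherwise the Newton step makes the errors at most `1` cofinally closed under products, so they
define a coarsening. There `f(a)` is a nonunit, and the minimal polynomial of `a` is congruent to a
power of `X - a`. Descent of the residue gives `c` with an error below every error at most `1`,
including its own. -/
theorem not_forall_valuation_aeval_le [FiniteDimensional F L] {w : Valuation L Γ₀}
    (hint : MinpolyIntegral F w) {a : L} (ha : w a ≤ 1) (hlim : NoBestApproximation F w a)
    (hp : ∀ j : ℕ, 0 < j → j < (minpoly F a).natDegree → w (j : L) = 1) {f : F[X]}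
    (hfp : f.natDegree < (minpoly F a).natDegree)
    (hf : ∀ i, w (algebraMap F L (f.coeff i)) ≤ 1)
    (hfu : ∃ i, w (algebraMap F L (f.coeff i)) = 1)
    (hf1 : ∀ c : F, w (algebraMap F L c) ≤ 1 → w (algebraMap F L (f.derivative.eval c)) = 1) :
    ¬ ∀ c : F, w (aeval a f) ≤ w (a - algebraMap F L c) := by
  intro hfa
  let S : Set Γ₀ := {s | s ≤ 1 ∧ ∃ c : F, w (a - algebraMap F L c) = s}
  have h1 : ∃ s ∈ S, s ≤ 1 := ⟨w a, ⟨ha, 0, by simp⟩, ha⟩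
  have hmul : ∀ s ∈ S, ∀ t ∈ S, ∃ r ∈ S, r ≤ s * t := by
    have aux : ∀ s ∈ S, ∀ t ∈ S, s ≤ t → ∃ r ∈ S, r ≤ s * t := by
      rintro s ⟨hs1, c, rfl⟩ t ⟨ht1, -⟩ hst
      obtain ⟨c', hc'⟩ := exists_valuation_sub_le_sq ha hlim hf hf1 hfa c hs1
      rw [sq] at hc'
      exact ⟨_, ⟨hc'.trans (mul_le_one' hs1 hs1), c', rfl⟩, hc'.trans (by gcongr)⟩
    intro s hs t ht
    rcases le_total s t with h | h
    · exact aux s hs t ht h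
    · rw [mul_comm]; exact aux t ht s hs h
  have h0 : ∀ s ∈ S, 0 < s := by
    rintro s ⟨-, c, rfl⟩
    obtain ⟨c', hc'⟩ := hlim c
    exact (zero_le).trans_lt hc'
  have hlt : ∀ x, (∀ c : F, w (a - algebraMap F L c) ≤ 1 → w x ≤ w (a - algebraMap F L c)) →
      (coarsening w S h1 hmul).valuation x < 1 := by
    intro x hx
    rw [valuation_coarsening_lt_one_iff w S h1 hmul h0]
    rintro s ⟨hs, c, rfl⟩
    obtain ⟨c', hc'⟩ := hlim c
    exact (hx c' (hc'.le.trans hs)).trans_lt hc'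
  obtain ⟨c, hc⟩ := exists_valuation_sub_lt_one (coarsening w S h1 hmul)
    (mem_coarsening w S h1 hmul ha) (f := f) (g := minpoly F a)
    (fun i => mem_coarsening w S h1 hmul (hf i))
    (hfu.imp fun i hi => valuation_coarsening_eq_one w S h1 hmul hi)
    (hlt _ fun c _ => hfa c) hfp
    (fun i => hlt _ fun c hc => by
      obtain ⟨d, hd0, hd⟩ := hlim.exists_eq c
      rw [← hd]
      exact minpoly_coeff_sub_pow_le hint ha hd0 (hd.trans_le hc) hd.ge i)
    (fun j hj hjp => valuation_coarsening_eq_one w S h1 hmul (hp j hj hjp))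
  rw [valuation_coarsening_lt_one_iff w S h1 hmul h0] at hc
  have hc1 : w (a - algebraMap F L c) ≤ 1 := by
    obtain ⟨s, hs, hs1⟩ := h1
    exact (hc s hs).le.trans hs1
  exact (hc _ ⟨hc1, c, rfl⟩).false

end Newton

/-! ### Taylor expansion along approximations, in the manner of Kaplansky -/

section Approximation

open Filter

variable {F L Γ₀ : Type*} [Field F] [Field L] [Algebra F L] [LinearOrderedCommGroupWithZero Γ₀]

variable (F) in
/-- The filter of elements `c ∈ F` approximating `b` as well as possible. -/
def approxFilter (w : Valuation L Γ₀) (b : L) : Filter F :=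
  ⨅ c₀ : F, 𝓟 {c | w (b - algebraMap F L c) ≤ w (b - algebraMap F L c₀)}

theorem hasBasis_approxFilter (w : Valuation L Γ₀) (b : L) :
    (approxFilter F w b).HasBasis (fun _ : F => True)
      fun c₀ => {c | w (b - algebraMap F L c) ≤ w (b - algebraMap F L c₀)} := by
  refine hasBasis_iInf_principal fun c₁ c₂ => ?_
  rcases le_total (w (b - algebraMap F L c₁)) (w (b - algebraMap F L c₂)) with h | h
  · exact ⟨c₁, fun c hc => hc, fun c hc => le_trans hc h⟩
  · exact ⟨c₂, fun c hc => le_trans hc h, fun c hc => hc⟩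

theorem eventually_approxFilter {w : Valuation L Γ₀} {b : L} {P : F → Prop} :
    (∀ᶠ c in approxFilter F w b, P c) ↔ ∃ c₀ : F, ∀ c : F,
      w (b - algebraMap F L c) ≤ w (b - algebraMap F L c₀) → P c := by
  rw [(hasBasis_approxFilter w b).eventually_iff]
  simp

instance neBot_approxFilter (w : Valuation L Γ₀) (b : L) : (approxFilter F w b).NeBot :=
  (hasBasis_approxFilter w b).neBot_iff.2 fun {c} _ => ⟨c, le_rfl⟩

theorem eventually_le_approxFilter (w : Valuation L Γ₀) (b : L) (c₀ : F) :
    ∀ᶠ c in approxFilter F w b, w (b - algebraMap F L c) ≤ w (b - algebraMap F L c₀) :=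
  eventually_approxFilter.2 ⟨c₀, fun _ h => h⟩

theorem NoBestApproximation.pos {w : Valuation L Γ₀} {b : L} (hb : NoBestApproximation F w b)
    (c : F) : 0 < w (b - algebraMap F L c) := by
  obtain ⟨c', hc'⟩ := hb c
  exact (zero_le).trans_lt hc'

/-- The two derivatives differ by the factor `i!`, a unit for `i < p`. -/
theorem valuation_eval_hasseDeriv {w : Valuation L Γ₀} {p : ℕ}
    (hp : ∀ j : ℕ, 0 < j → j < p → w (j : L) = 1) (f : F[X]) {i : ℕ} (hi : i < p) (c : F) :
    w (algebraMap F L ((hasseDeriv i f).eval c)) =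
      w (algebraMap F L ((derivative^[i] f).eval c)) := by
  have hfac : ∀ i : ℕ, i < p → w ((i.factorial : ℕ) : L) = 1 := by
    intro i
    induction i with
    | zero => simp
    | succ i ih =>
      intro h
      rw [Nat.factorial_succ, Nat.cast_mul, map_mul, hp _ i.succ_pos h, ih (by omega), one_mul]
  have h : i.factorial • hasseDeriv i f = derivative^[i] f :=
    congrFun (factorial_smul_hasseDeriv (R := F) i) f
  rw [← h, nsmul_eq_mul, eval_natCast_mul, map_mul, map_natCast, map_mul, hfac i hi, one_mul]

theorem aeval_ne_zero_of_natDegree_lt {b : L} {f : F[X]} (hf : f ≠ 0)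
    (hdeg : f.natDegree < (minpoly F b).natDegree) : aeval b f ≠ 0 := by
  intro h
  have := natDegree_le_of_dvd (minpoly.dvd F b h) hf
  omega

/-- If the Taylor expansion of `f` at good approximations of `b` is dominated by its linear term,
then the values `w (f c)` do not decrease indefinitely. -/
theorem exists_mul_lt_valuation_aeval [FiniteDimensional F L] {w : Valuation L Γ₀}
    (hint : MinpolyIntegral F w) {b : L} (hlim : NoBestApproximation F w b)
    (hp : ∀ j : ℕ, 0 < j → j < (minpoly F b).natDegree → w (j : L) = 1) {f : F[X]}
    (hfp : f.natDegree < (minpoly F b).natDegree)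
    (hd0 : aeval b f.derivative ≠ 0)
    (hd1 : ∀ᶠ c in approxFilter F w b,
      w (algebraMap F L (f.derivative.eval c)) = w (aeval b f.derivative))
    (hlin : ∀ᶠ c in approxFilter F w b, w (aeval b f - algebraMap F L (f.eval c)) =
      w (aeval b f.derivative) * w (b - algebraMap F L c))
    (hhigh : ∀ i, 2 ≤ i → i ≤ f.natDegree → ∀ᶠ c in approxFilter F w b,
      w (algebraMap F L ((hasseDeriv i f).eval c)) * w (b - algebraMap F L c) ^ (i - 1) <
        w (aeval b f.derivative)) :
    ∃ c : F, w (aeval b f.derivative) * w (b - algebraMap F L c) < w (aeval b f) := by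
  by_contra! hcon
  have hhigh' : ∀ᶠ c in approxFilter F w b, ∀ i ∈ Finset.Icc 2 f.natDegree,
      w (algebraMap F L ((hasseDeriv i f).eval c)) * w (b - algebraMap F L c) ^ (i - 1) <
        w (aeval b f.derivative) := by
    rw [Filter.eventually_all_finset]
    intro i hi
    rw [Finset.mem_Icc] at hi
    exact hhigh i hi.1 hi.2
  obtain ⟨c₀, hc₀⟩ := eventually_approxFilter.1 ((hd1.and hlin).and hhigh')
  obtain ⟨⟨h1, h2⟩, h3⟩ := hc₀ c₀ le_rfl
  obtain ⟨d, hd, hwd⟩ := hlim.exists_eq c₀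
  set β := w (aeval b f.derivative) with hβ
  have hβ0 : β ≠ 0 := (Valuation.ne_zero_iff w).2 hd0
  have hdL : algebraMap F L d ≠ 0 := (_root_.map_ne_zero _).2 hd
  have hwd0 : w (algebraMap F L d) ≠ 0 := (Valuation.ne_zero_iff w).2 hdL
  set s := f.derivative.eval c₀ with hs
  have hsL : algebraMap F L s ≠ 0 := by
    rw [← Valuation.ne_zero_iff w, h1]
    exact hβ0
  -- Normalisation: `a` has value `1`, and `d X + c₀` carries it to `b`.
  set a : L := (b - algebraMap F L c₀) / algebraMap F L d with ha
  have hab : algebraMap F L d * a + algebraMap F L c₀ = b := by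
    rw [ha]; field_simp; ring
  have hbi : ∀ x : L, IsIntegral F x := fun x => Algebra.IsIntegral.isIntegral x
  have hdeg : (minpoly F a).natDegree = (minpoly F b).natDegree := by
    rw [← natDegree_minpoly_affine (c := c₀) (hbi a) hd, hab]
  have hsub : ∀ c : F, b - algebraMap F L (d * c + c₀) =
      algebraMap F L d * (a - algebraMap F L c) := by
    intro c
    rw [← hab, map_add, map_mul]; ring
  have hwa : w a = 1 := by
    rw [ha, map_div₀, hwd]
    exact div_self (hwd ▸ hwd0)
  have hlima : NoBestApproximation F w a := by
    intro c
    obtain ⟨c', hc'⟩ := hlim (d * c + c₀)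
    refine ⟨(c' - c₀) / d, ?_⟩
    have hc'' : d * ((c' - c₀) / d) + c₀ = c' := by field_simp; ring
    rw [← hc'', hsub, hsub, map_mul, map_mul] at hc'
    exact lt_of_mul_lt_mul_left' hc'
  -- This is `f(d X + c₀)` divided by `d f'(c₀)`: its linear coefficient is `1`, and `hcon`, `h2`
  -- and `h3` make the other coefficients integral.
  set g : F[X] := C (d * s)⁻¹ * (taylor c₀ f).comp (C d * X) with hg
  have hgcoeff : ∀ i, g.coeff i = (d * s)⁻¹ * ((hasseDeriv i f).eval c₀ * d ^ i) := by
    intro i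
    rw [hg, coeff_C_mul, comp_C_mul_X_coeff, taylor_coeff]
  have hgval : ∀ i, w (algebraMap F L (g.coeff i)) = (w (algebraMap F L d) * β)⁻¹ *
      (w (algebraMap F L ((hasseDeriv i f).eval c₀)) * w (algebraMap F L d) ^ i) := by
    intro i
    rw [hgcoeff]
    simp only [map_mul, map_inv₀, map_pow, h1]
  have hgeval : g = C (d * s)⁻¹ * f.comp (C d * X + C c₀) := by
    rw [hg, taylor_apply, comp_assoc]; simp
  have hone : w (algebraMap F L (g.coeff 1)) = 1 := by
    rw [hgval, hasseDeriv_one, h1, pow_one, mul_comm β]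
    exact inv_mul_cancel₀ (mul_ne_zero hwd0 hβ0)
  have hgderiv : ∀ c : F, g.derivative.eval c = s⁻¹ * f.derivative.eval (d * c + c₀) := by
    intro c
    rw [hgeval, derivative_C_mul, derivative_comp]
    simp only [eval_mul, eval_C, eval_comp, eval_add, eval_X, derivative_add, derivative_C_mul,
      derivative_X, derivative_C, mul_one, add_zero]
    have : s ≠ 0 := fun h => hsL (by rw [h, map_zero])
    field_simp
  have hga : aeval a g = (algebraMap F L (d * s))⁻¹ * aeval b f := by
    rw [hgeval, map_mul, aeval_C, map_inv₀, aeval_comp]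
    have : aeval a (C d * X + C c₀ : F[X]) = b := by simp [hab]
    rw [this]
  refine not_forall_valuation_aeval_le hint hwa.le hlima (f := g) (by rwa [hdeg]) ?_ ?_ ⟨1, hone⟩
    ?_ ?_
  · rw [hdeg, hgeval]
    refine (natDegree_C_mul_le _ _).trans_lt ?_
    rwa [natDegree_comp, natDegree_linear hd, mul_one]
  · intro i
    rw [hgval]
    rw [inv_mul_le_one₀ (zero_lt_iff.2 (mul_ne_zero hwd0 hβ0))]
    obtain rfl | rfl | hi : i = 0 ∨ i = 1 ∨ 2 ≤ i := by omega
    · rw [hasseDeriv_zero', pow_zero, mul_one]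
      have h4 : algebraMap F L (f.eval c₀) =
        aeval b f - (aeval b f - algebraMap F L (f.eval c₀)) := by ring
      rw [h4]
      refine (w.map_sub _ _).trans (max_le ?_ ?_)
      · rw [hwd, mul_comm]; exact hcon c₀
      · rw [h2, hwd, mul_comm]
    · rw [hasseDeriv_one, h1, pow_one, mul_comm]
    · rcases le_or_gt i f.natDegree with hin | hin
      · have h4 := h3 i (Finset.mem_Icc.2 ⟨hi, hin⟩)
        have h5 : w (algebraMap F L d) ^ i = w (algebraMap F L d) ^ (i - 1) *
          w (algebraMap F L d) := by rw [← pow_succ]; congr 1; omega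
        rw [h5, ← mul_assoc, mul_comm]
        rw [← hwd] at h4
        gcongr
      · rw [hasseDeriv_eq_zero_of_lt_natDegree f i hin]
        simp
  · intro c hc
    have h4 : w (algebraMap F L (f.derivative.eval (d * c + c₀))) = β := by
      refine (hc₀ _ ?_).1.1
      rw [hsub, map_mul, ← hwd]
      refine mul_le_of_le_one_right' ?_
      exact (w.map_sub _ _).trans (max_le hwa.le hc)
    rw [hgderiv, map_mul, map_mul, h4, map_inv₀, map_inv₀, h1]
    exact inv_mul_cancel₀ hβ0
  · intro c
    have h4 := hcon (d * c + c₀)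
    rw [hsub, map_mul] at h4
    rw [hga, map_mul, map_inv₀, map_mul, map_mul, h1,
      inv_mul_le_iff₀ (zero_lt_iff.2 (mul_ne_zero hwd0 hβ0))]
    calc w (aeval b f) ≤ _ := h4
      _ = _ := by rw [← mul_assoc, mul_comm β]

/-- Induction on the degree. The derivatives of `f` have smaller degree, so their values at `c`
stabilise and the higher Taylor terms are dominated by the linear one. The second claim then follows
from `exists_mul_lt_valuation_aeval`. -/
theorem eventually_valuation_aeval_sub [FiniteDimensional F L] {w : Valuation L Γ₀}
    (hint : MinpolyIntegral F w) {b : L} (hlim : NoBestApproximation F w b)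
    (hp : ∀ j : ℕ, 0 < j → j < (minpoly F b).natDegree → w (j : L) = 1) (n : ℕ) :
    ∀ f : F[X], f.natDegree = n → n < (minpoly F b).natDegree →
    (∀ᶠ c in approxFilter F w b, w (aeval b f - algebraMap F L (f.eval c)) =
      w (aeval b f.derivative) * w (b - algebraMap F L c)) ∧
    (f ≠ 0 → ∀ᶠ c in approxFilter F w b,
      w (aeval b f - algebraMap F L (f.eval c)) < w (aeval b f)) := by
  induction n using Nat.strong_induction_on with
  | _ n ih =>
  intro f hfn hn
  rcases Nat.eq_zero_or_pos n with rfl | hn0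
  · rw [eq_C_of_natDegree_eq_zero hfn]
    refine ⟨.of_forall fun c => by simp, fun h0 => .of_forall fun c => ?_⟩
    have : f.coeff 0 ≠ 0 := fun h => h0 (by rw [h, C_0])
    simpa [zero_lt_iff] using this
  set D : ℕ → F[X] := fun j => derivative^[j] f with hD
  have hD1 : D 1 = f.derivative := rfl
  have hDsucc : ∀ j, D (j + 1) = (D j).derivative := fun j => Function.iterate_succ_apply' _ _ _
  have hDdeg : ∀ j, (D j).natDegree ≤ n - j := fun j => hfn ▸ natDegree_iterate_derivative f j
  have hnF : (n : F) ≠ 0 := by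
    intro h
    have h1 := hp n hn0 hn
    rw [← map_natCast (algebraMap F L), h, map_zero, map_zero] at h1
    exact zero_ne_one h1
  have hf' : D 1 ≠ 0 := by
    intro h
    have h1 := coeff_derivative f (n - 1)
    rw [← hD1, h, coeff_zero, Nat.sub_add_cancel hn0, ← Nat.cast_succ, Nat.succ_eq_add_one,
      Nat.sub_add_cancel hn0, ← hfn] at h1
    rcases mul_eq_zero.1 h1.symm with h2 | h2
    · have : f = 0 := leadingCoeff_eq_zero.1 h2
      rw [this, natDegree_zero] at hfn
      omega
    · rw [hfn] at h2
      exact hnF h2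
  set β := w (aeval b (D 1)) with hβ
  have hβ0 : aeval b (D 1) ≠ 0 :=
    aeval_ne_zero_of_natDegree_lt hf' ((hDdeg 1).trans_lt (by omega))
  have hβpos : 0 < β := (Valuation.pos_iff w).2 hβ0
  have hIH : ∀ j, 1 ≤ j → _ := fun j hj => ih (D j).natDegree (by have := hDdeg j; omega) (D j) rfl
    (by have := hDdeg j; omega)
  have hstep : ∀ j, 1 ≤ j → D j ≠ 0 → ∀ᶠ c in approxFilter F w b,
      w (aeval b (D (j + 1))) * w (b - algebraMap F L c) < w (aeval b (D j)) := by
    intro j hj h0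
    filter_upwards [(hIH j hj).1, (hIH j hj).2 h0] with c h1 h2
    rwa [hDsucc, ← h1]
  -- Telescoping `hstep`: each further derivative costs one more factor `b - c`.
  have hchain : ∀ j, ∀ᶠ c in approxFilter F w b,
      w (aeval b (D (j + 2))) * w (b - algebraMap F L c) ^ (j + 1) < β := by
    intro j
    induction j with
    | zero => simpa using hstep 1 le_rfl hf'
    | succ j ihj =>
      by_cases h0 : D (j + 2) = 0
      · have : D (j + 1 + 2) = 0 := by
          rw [show j + 1 + 2 = (j + 2) + 1 from rfl, hDsucc, h0, derivative_zero]
        exact .of_forall fun c => by simpa [this] using hβpos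
      · filter_upwards [ihj, hstep (j + 2) (by omega) h0] with c h1 h2
        refine lt_of_le_of_lt ?_ h1
        rw [pow_succ', ← mul_assoc]
        exact mul_le_mul_left h2.le _
  have hconst : ∀ j, 1 ≤ j → ∀ᶠ c in approxFilter F w b,
      w (algebraMap F L ((D j).eval c)) = w (aeval b (D j)) := by
    intro j hj
    by_cases h0 : D j = 0
    · exact .of_forall fun c => by simp [h0]
    · filter_upwards [(hIH j hj).2 h0] with c h1
      rw [Valuation.map_sub_swap] at h1
      exact Valuation.map_eq_of_sub_lt w h1
  have hhigh : ∀ i, 2 ≤ i → i ≤ f.natDegree → ∀ᶠ c in approxFilter F w b,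
      w (algebraMap F L ((hasseDeriv i f).eval c)) * w (b - algebraMap F L c) ^ (i - 1) < β := by
    intro i hi hin
    obtain ⟨j, rfl⟩ := Nat.exists_eq_add_of_le' hi
    filter_upwards [hchain j, hconst (j + 2) (by omega)] with c h1 h2
    rw [valuation_eval_hasseDeriv hp f (by omega)]
    change w (algebraMap F L ((D (j + 2)).eval c)) * _ < β
    rw [h2]
    exact h1
  have hlin : ∀ᶠ c in approxFilter F w b, w (aeval b f - algebraMap F L (f.eval c)) =
      β * w (b - algebraMap F L c) := by
    have hhigh' : ∀ᶠ c in approxFilter F w b, ∀ i ∈ Finset.Icc 2 f.natDegree,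
        w (algebraMap F L ((hasseDeriv i f).eval c)) * w (b - algebraMap F L c) ^ (i - 1) < β := by
      rw [Filter.eventually_all_finset]
      intro i hi
      rw [Finset.mem_Icc] at hi
      exact hhigh i hi.1 hi.2
    filter_upwards [hhigh', hconst 1 le_rfl] with c h1 h2
    have hc := hlim.pos c
    set δ := b - algebraMap F L c
    have htaylor : aeval b f = ∑ i ∈ Finset.range (n + 1),
        algebraMap F L ((hasseDeriv i f).eval c) * δ ^ i := by
      have h3 : aeval b f = aeval δ (taylor c f) := by
        rw [taylor_apply, aeval_comp]
        simp [δ]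
      rw [h3, aeval_eq_sum_range, natDegree_taylor, hfn]
      refine Finset.sum_congr rfl fun i _ => ?_
      rw [taylor_coeff, Algebra.smul_def]
    have hsplit : aeval b f - algebraMap F L (f.eval c) =
        algebraMap F L ((D 1).eval c) * δ + ∑ i ∈ Finset.Icc 2 n,
          algebraMap F L ((hasseDeriv i f).eval c) * δ ^ i := by
      rw [htaylor, Finset.range_eq_Ico, Finset.sum_eq_sum_Ico_succ_bot (by omega),
        Finset.sum_eq_sum_Ico_succ_bot (by omega)]
      simp only [hasseDeriv_zero', pow_zero, mul_one, zero_add, hasseDeriv_one, pow_one, hD1]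
      rw [add_sub_cancel_left]
      rfl
    have hlow : w (algebraMap F L ((D 1).eval c) * δ) = β * w δ := by rw [map_mul, h2]
    have hsum : w (∑ i ∈ Finset.Icc 2 n, algebraMap F L ((hasseDeriv i f).eval c) * δ ^ i) <
        w (algebraMap F L ((D 1).eval c) * δ) := by
      rw [hlow]
      refine Valuation.map_sum_lt w (mul_ne_zero hβpos.ne' hc.ne') fun i hi => ?_
      have h3 := h1 i (hfn ▸ hi)
      rw [Finset.mem_Icc] at hi
      rw [map_mul, map_pow, show w δ ^ i = w δ ^ (i - 1) * w δ by
        rw [← pow_succ]; congr 1; omega, ← mul_assoc]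
      exact mul_lt_mul_of_pos_right h3 hc
    rw [hsplit, Valuation.map_add_eq_of_lt_left w hsum, hlow]
  refine ⟨hlin, fun _ => ?_⟩
  obtain ⟨c₁, hc₁⟩ := exists_mul_lt_valuation_aeval hint hlim hp (by omega) hβ0 (hconst 1 le_rfl)
    hlin hhigh
  filter_upwards [hlin, eventually_le_approxFilter w b c₁] with c h1 h2
  rw [h1]
  refine lt_of_le_of_lt ?_ hc₁
  exact mul_le_mul_right h2 _

theorem exists_aeval_eq_of_mem_adjoin [FiniteDimensional F L] {b x : L}
    (hx : x ∈ IntermediateField.adjoin F {b}) :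
    ∃ f : F[X], f.natDegree < (minpoly F b).natDegree ∧ aeval b f = x := by
  have hb : IsIntegral F b := Algebra.IsIntegral.isIntegral b
  rw [← IntermediateField.mem_toSubalgebra,
    IntermediateField.adjoin_simple_toSubalgebra_of_isAlgebraic hb.isAlgebraic,
    Algebra.adjoin_singleton_eq_range_aeval] at hx
  obtain ⟨f, rfl⟩ := hx
  refine ⟨f %ₘ minpoly F b, natDegree_modByMonic_lt _ (minpoly.monic hb) (minpoly.ne_one F b), ?_⟩
  exact aeval_modByMonic_eq_self_of_root (minpoly.aeval F b)

/-- The extension `F(b)|F` is immediate. -/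
theorem exists_valuation_sub_lt [FiniteDimensional F L] {w : Valuation L Γ₀}
    (hint : MinpolyIntegral F w) {b : L} (hlim : NoBestApproximation F w b)
    (hp : ∀ j : ℕ, 0 < j → j < (minpoly F b).natDegree → w (j : L) = 1) {x : L}
    (hx : x ∈ IntermediateField.adjoin F {b}) (hx0 : x ≠ 0) :
    ∃ c : F, w (x - algebraMap F L c) < w x := by
  obtain ⟨f, hfdeg, rfl⟩ := exists_aeval_eq_of_mem_adjoin hx
  have hf0 : f ≠ 0 := by rintro rfl; simp at hx0
  obtain ⟨c, hc⟩ :=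
    ((eventually_valuation_aeval_sub hint hlim hp _ f rfl hfdeg).2 hf0).exists
  exact ⟨f.eval c, hc⟩

/-- The distances of all elements of `F(b) \ F` from `F` agree up to shifts by values of `F`. -/
theorem exists_mul_cofinal [FiniteDimensional F L] {w : Valuation L Γ₀}
    (hint : MinpolyIntegral F w) {b : L} (hlim : NoBestApproximation F w b)
    (hp : ∀ j : ℕ, 0 < j → j < (minpoly F b).natDegree → w (j : L) = 1) {x : L}
    (hx : x ∈ IntermediateField.adjoin F {b}) (hxF : x ∉ Set.range (algebraMap F L)) :
    ∃ z : F, z ≠ 0 ∧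
      (∀ y : F, ∃ c : F, w (algebraMap F L z * (b - algebraMap F L c)) ≤ w (x - algebraMap F L y)) ∧
      ∀ c : F, ∃ y : F, w (x - algebraMap F L y) ≤ w (algebraMap F L z * (b - algebraMap F L c)) := by
  obtain ⟨f, hfdeg, rfl⟩ := exists_aeval_eq_of_mem_adjoin hx
  have hgood := eventually_valuation_aeval_sub hint hlim hp _ f rfl hfdeg
  -- A vanishing derivative would give `f(b) = f(c)` for some `c`, placing `x` in `F`.
  have hder : aeval b f.derivative ≠ 0 := by
    intro h
    obtain ⟨c, hc⟩ := hgood.1.exists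
    rw [h, map_zero, zero_mul, Valuation.zero_iff, sub_eq_zero] at hc
    exact hxF ⟨_, hc.symm⟩
  -- Immediacy of `F(b)|F` makes the value of `f'(b)` a value of `F`.
  obtain ⟨z, hz⟩ : ∃ z : F, w (algebraMap F L z) = w (aeval b f.derivative) := by
    have hmem : aeval b f.derivative ∈ IntermediateField.adjoin F {b} :=
      IntermediateField.algebra_adjoin_le_adjoin _ _ (aeval_mem_adjoin_singleton F b)
    obtain ⟨c, hc⟩ := exists_valuation_sub_lt hint hlim hp hmem hder
    rw [Valuation.map_sub_swap] at hc
    exact ⟨c, Valuation.map_eq_of_sub_lt w hc⟩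
  have hz0 : z ≠ 0 := by
    rintro rfl
    rw [map_zero, map_zero, eq_comm, Valuation.zero_iff] at hz
    exact hder hz
  refine ⟨z, hz0, fun y => ?_, fun c => ?_⟩
  -- Subtracting the constant `y` does not change the derivative, so the strict estimate for `f - y`
  -- bounds `z (b - c)` by `x - y`.
  · have hgy := eventually_valuation_aeval_sub hint hlim hp _ (f - C y) rfl
      (by rwa [natDegree_sub_C])
    have hne : f - C y ≠ 0 := by
      intro h
      rw [sub_eq_zero] at h
      exact hxF ⟨y, by rw [h, aeval_C]⟩
    obtain ⟨c, h1, h2⟩ := (hgy.1.and (hgy.2 hne)).exists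
    have h3 : aeval b (f - C y) = aeval b f - algebraMap F L y := by simp
    rw [h1, derivative_sub, derivative_C, sub_zero, h3, ← hz, ← map_mul] at h2
    exact ⟨c, h2.le⟩
  · obtain ⟨c', h1, h2⟩ := (hgood.1.and (eventually_le_approxFilter w b c)).exists
    exact ⟨f.eval c', by rw [h1, map_mul, hz]; exact mul_le_mul_right h2 _⟩

end Approximation

/-! ### Uniqueness of the extension and integrality -/

section Integrality

variable {K L Γ : Type*} [Field K] [Field L] [Algebra K L]
  [AddCommGroup Γ] [LinearOrder Γ] [IsOrderedAddMonoid Γ]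

theorem mem_valuationRing (v : AddValuation L (WithTop Γ)) {x : L} :
    x ∈ valuationRing v ↔ 0 ≤ v x := Iff.rfl

theorem valuation_eq_top_iff (v : AddValuation L (WithTop Γ)) {x : L} : v x = ⊤ ↔ x = 0 :=
  v.top_iff

/-- Dictionary between the additive `v` and the multiplicative valuation of its ring; the order is
reversed. -/
theorem valuation_valuationRing_le_iff (v : AddValuation L (WithTop Γ)) {x y : L} :
    (valuationRing v).valuation x ≤ (valuationRing v).valuation y ↔ v y ≤ v x := by
  rcases eq_or_ne y 0 with rfl | hy
  · rw [map_zero, v.map_zero, top_le_iff, valuation_eq_top_iff, le_zero_iff, Valuation.zero_iff]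
  · have hvy : v y ≠ ⊤ := fun h => hy ((valuation_eq_top_iff v).1 h)
    have h1 : v x = v (x / y) + v y := by rw [← v.map_mul, div_mul_cancel₀ x hy]
    have h2 : (valuationRing v).valuation x ≤ (valuationRing v).valuation y ↔
        (valuationRing v).valuation (x / y) ≤ 1 := by
      rw [map_div₀, div_le_one₀ ((Valuation.pos_iff _).2 hy)]
    rw [h2, ValuationSubring.valuation_le_one_iff, mem_valuationRing, h1]
    have h3 := WithTop.add_le_add_iff_right (x := 0) (y := v (x / y)) hvy
    rw [zero_add] at h3
    exact h3.symm

theorem valuation_valuationRing_lt_iff (v : AddValuation L (WithTop Γ)) {x y : L} :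
    (valuationRing v).valuation x < (valuationRing v).valuation y ↔ v y < v x := by
  rw [← not_le, valuation_valuationRing_le_iff, not_le]

variable (K) in
/-- The inclusion of the valuation ring of `K` in `L`. -/
def valuationRingHom (v : AddValuation L (WithTop Γ)) : valuationRing (restrict K v) →+* L :=
  (algebraMap K L).comp (valuationRing (restrict K v)).subtype

open Algebra IsLocalRing in
-- If `x` is not integral, some valuation ring `V` of `L` dominates the valuation ring of `K` and
-- has `x⁻¹` as a nonunit. Then `V` extends `v` on `K` without containing `x`, against uniqueness.
theorem IsUV.isIntegralElem {v : AddValuation L (WithTop Γ)} (huv : IsUV K v) {x : L}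
    (hx : 0 ≤ v x) : (valuationRingHom K v).IsIntegralElem x := by
  by_contra hxR
  obtain rfl | hx0 := eq_or_ne x 0
  · exact hxR (RingHom.isIntegralElem_zero _)
  let R : LocalSubring L := LocalSubring.range (valuationRingHom K v)
  have hRmem : ∀ y, y ∈ R.toSubring ↔ ∃ c, valuationRingHom K v c = y := fun y => Iff.rfl
  let _ := invertibleOfNonzero hx0
  let B := R.toSubring[x⁻¹]
  let xinv : B.toSubring := ⟨x⁻¹, subset_adjoin rfl⟩
  -- Were this the unit ideal, `x` would be a root of a polynomial with unit leading coefficient,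
  -- hence integral.
  have hne : (maximalIdeal R.toSubring).map (algebraMap _ B) + .span {xinv} ≠ ⊤ := by
    intro eq
    obtain ⟨p, hp, hpx⟩ := exists_aeval_invOf_eq_zero_of_idealMap_adjoin_sup_span_eq_top _ _
      (maximalIdeal.isMaximal R.toSubring).ne_top eq
    have H : IsUnit p.leadingCoeff := of_not_not fun h ↦ by simpa using sub_mem h hp
    have hint : IsIntegral R.toSubring x :=
      ⟨.C H.unit⁻¹.1 * p, by simp [Polynomial.Monic], by
        have hpx' : aeval x p = 0 := by simpa using hpx
        rw [eval₂_mul, ← aeval_def x p, hpx', mul_zero]⟩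
    let e : valuationRing (restrict K v) ≃+* R.toSubring := RingEquiv.ofBijective
      ((valuationRingHom K v).codRestrict R.toSubring fun c => (hRmem _).2 ⟨c, rfl⟩)
      ⟨fun a b h => Subtype.ext ((algebraMap K L).injective (congrArg Subtype.val h)),
        fun ⟨y, hy⟩ => by
          obtain ⟨c, hc⟩ := (hRmem y).1 hy
          exact ⟨c, Subtype.ext hc⟩⟩
    refine hxR (RingHom.IsIntegralElem.of_comp (f := (e.symm : R.toSubring →+* _)) ?_)
    have he : (valuationRingHom K v).comp (e.symm : R.toSubring →+* _) =
        algebraMap R.toSubring L := by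
      ext y
      exact congrArg Subtype.val (e.apply_symm_apply y)
    rw [he]
    exact hint
  obtain ⟨V, hBV, hV⟩ := Ideal.image_subset_nonunits_valuationSubring (A := B.toSubring) _ hne
  have hxV : x ∉ V := (V.inv_mem_nonunits_iff.mp <|
      hV ⟨_, le_add_self (α := Ideal B) (Ideal.subset_span rfl), rfl⟩).resolve_left hx0
  have hOV : ∀ c, valuationRingHom K v c ∈ V := fun c =>
    hBV (B.algebraMap_mem ⟨_, (hRmem _).2 ⟨c, rfl⟩⟩)
  have hmV : ∀ c, ¬ IsUnit c → valuationRingHom K v c ∈ V.nonunits := by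
    intro c hc
    refine hV ⟨algebraMap R.toSubring B ⟨_, (hRmem _).2 ⟨c, rfl⟩⟩,
      le_self_add (α := Ideal B) (Ideal.mem_map_of_mem _ ?_), rfl⟩
    rw [mem_maximalIdeal, mem_nonunits_iff]
    intro hu
    obtain ⟨⟨y, hy⟩, hcy⟩ := hu.exists_right_inv
    obtain ⟨b, rfl⟩ := (hRmem y).1 hy
    refine hc (IsUnit.of_mul_eq_one b (Subtype.ext ((algebraMap K L).injective ?_)))
    have h1 : valuationRingHom K v c * valuationRingHom K v b = 1 := congrArg Subtype.val hcy
    rw [← map_mul] at h1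
    rw [OneMemClass.coe_one, map_one]
    exact h1
  have hcomap : V.comap (algebraMap K L) = valuationRing (restrict K v) := by
    ext c
    rw [ValuationSubring.mem_comap]
    refine ⟨fun hc => ?_, fun hc => hOV ⟨c, hc⟩⟩
    by_contra hcO
    have hcinv := ((valuationRing (restrict K v)).mem_or_inv_mem c).resolve_left hcO
    have hnu := hmV ⟨c⁻¹, hcinv⟩ fun hu => by
      obtain ⟨⟨y, hy⟩, hcy⟩ := hu.exists_right_inv
      have h1 : c⁻¹ * y = 1 := congrArg Subtype.val hcy
      have hc0 : c ≠ 0 := by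
        rintro rfl
        simp at h1
      have : y = c := by
        field_simp at h1
        exact h1
      exact hcO (this ▸ hy)
    have h2 : (algebraMap K L c)⁻¹ ∈ V.nonunits := by
      rw [← map_inv₀]; exact hnu
    rcases V.inv_mem_nonunits_iff.1 h2 with h3 | h3
    · have : c = 0 := (algebraMap K L).injective (by rw [h3, map_zero])
      exact hcO (this ▸ (valuationRing (restrict K v)).zero_mem)
    · exact h3 hc
  have := huv V hcomap
  exact hxV (this ▸ hx)

/-- The valuation ring of `E` is integrally closed, so the minimal polynomial over `E` of an element
integral over it already has coefficients in it. -/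
theorem IsUV.minpolyIntegral {v : AddValuation L (WithTop Γ)} (huv : IsUV K v)
    (E : IntermediateField K L) : MinpolyIntegral E (valuationRing v).valuation := by
  intro x hx i
  rw [ValuationSubring.valuation_le_one_iff] at hx ⊢
  have hxK := huv.isIntegralElem hx
  set O := (valuationRing v).comap (algebraMap E L)
  let φ : O →+* L := (algebraMap E L).comp O.subtype
  let ι : valuationRing (restrict K v) →+* O :=
    ((algebraMap K E).comp (valuationRing (restrict K v)).subtype).codRestrict O.toSubring
      fun c => c.2
  have hxE : φ.IsIntegralElem x := RingHom.IsIntegralElem.of_comp (f := ι) hxK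
  let _ : Algebra O L := φ.toAlgebra
  have : IsScalarTower O E L := IsScalarTower.of_algebraMap_eq fun _ => rfl
  rw [minpoly.isIntegrallyClosed_eq_field_fractions' (R := O) E hxE, coeff_map]
  exact ((minpoly O x).coeff i).2

end Integrality

/-! ### Valuation independence -/

section FundamentalInequality

variable {F L Γ : Type*} [Field F] [Field L] [Algebra F L]
  [AddCommGroup Γ] [LinearOrder Γ] [IsOrderedAddMonoid Γ]

theorem exists_coe_eq (v : AddValuation L (WithTop Γ)) {x : L} (hx : x ≠ 0) :
    ∃ γ : Γ, v x = (γ : WithTop Γ) := by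
  have : v x ≠ ⊤ := fun h => hx ((valuation_eq_top_iff v).1 h)
  exact ⟨(v x).untop this, (WithTop.coe_untop _ _).symm⟩

/-- A linear combination of elements with linearly independent residues has the same value as one
of its coefficients. -/
theorem exists_valuation_sum_eq {ι : Type*} [Fintype ι] (v : AddValuation L (WithTop Γ))
    {x : ι → L} (hx : ∀ c : ι → F, (∀ j, 0 ≤ v (algebraMap F L (c j))) →
      0 < v (∑ j, algebraMap F L (c j) * x j) → ∀ j, 0 < v (algebraMap F L (c j)))
    (hx0 : ∀ j, 0 ≤ v (x j)) {c : ι → F} (hc : c ≠ 0) :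
    ∃ d : F, d ≠ 0 ∧ v (∑ j, algebraMap F L (c j) * x j) = v (algebraMap F L d) := by
  obtain ⟨j₁, hj₁⟩ := Function.ne_iff.1 hc
  -- After division by a coefficient of least value, one coefficient is `1`, so `hx` forces the sum
  -- to be a unit.
  obtain ⟨j₀, -, hj₀⟩ := Finset.exists_min_image Finset.univ (fun j => v (algebraMap F L (c j)))
    ⟨j₁, Finset.mem_univ _⟩
  have hc0 : c j₀ ≠ 0 := by
    intro h
    have h1 := hj₀ j₁ (Finset.mem_univ _)
    rw [h, map_zero, v.map_zero, top_le_iff, valuation_eq_top_iff] at h1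
    exact hj₁ ((algebraMap F L).injective (by rw [h1, Pi.zero_apply, map_zero]))
  have hcL : algebraMap F L (c j₀) ≠ 0 := (_root_.map_ne_zero _).2 hc0
  refine ⟨c j₀, hc0, ?_⟩
  have hint : ∀ j, 0 ≤ v (algebraMap F L (c j / c j₀)) := by
    intro j
    rw [map_div₀, ← mem_valuationRing, ← ValuationSubring.valuation_le_one_iff, map_div₀]
    refine div_le_one_of_le₀ ?_ (zero_le)
    exact (valuation_valuationRing_le_iff v).2 (hj₀ j (Finset.mem_univ _))
  have hsum : ∑ j, algebraMap F L (c j) * x j =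
      algebraMap F L (c j₀) * ∑ j, algebraMap F L (c j / c j₀) * x j := by
    rw [Finset.mul_sum]
    refine Finset.sum_congr rfl fun j _ => ?_
    rw [map_div₀]
    field_simp
  have hge : 0 ≤ v (∑ j, algebraMap F L (c j / c j₀) * x j) :=
    v.map_le_sum fun j _ => by
      rw [v.map_mul]
      exact add_nonneg (hint j) (hx0 j)
  have hle : ¬ 0 < v (∑ j, algebraMap F L (c j / c j₀) * x j) := by
    intro h
    have h1 := hx _ hint h j₀
    rw [div_self hc0, map_one, v.map_one] at h1
    exact h1.false
  rw [hsum, v.map_mul, le_antisymm (not_lt.1 hle) hge, add_zero]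

/-- Grouped by `y q`, each nonzero inner sum has a value from `F`. The nonzero terms then have
distinct values because the `y q` lie in distinct cosets, so the dominant one cannot cancel. -/
theorem linearIndependent_mul_of_valuation {ι κ : Type*} [Fintype ι] [Fintype κ]
    (v : AddValuation L (WithTop Γ)) {x : ι → L}
    (hx : ∀ c : ι → F, (∀ j, 0 ≤ v (algebraMap F L (c j))) →
      0 < v (∑ j, algebraMap F L (c j) * x j) → ∀ j, 0 < v (algebraMap F L (c j)))
    (hx0 : ∀ j, 0 ≤ v (x j)) {y : κ → L} (hy0 : ∀ q, y q ≠ 0)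
    (hy : ∀ q r, ∀ d : F, d ≠ 0 → v (y q) = v (algebraMap F L d * y r) → q = r) :
    LinearIndependent F fun i : κ × ι => y i.1 * x i.2 := by
  classical
  rw [Fintype.linearIndependent_iff]
  intro c hc
  set s : κ → L := fun q => ∑ j, algebraMap F L (c (q, j)) * x j
  have hsum : ∑ q, y q * s q = 0 := by
    rw [Fintype.sum_prod_type] at hc
    rw [← hc]
    refine Finset.sum_congr rfl fun q _ => ?_
    rw [Finset.mul_sum]
    refine Finset.sum_congr rfl fun j _ => ?_
    rw [Algebra.smul_def]
    ring
  have hzero : ∀ q, (∀ j, c (q, j) = 0) ∨ s q ≠ 0 := by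
    intro q
    by_cases h : (fun j => c (q, j)) = 0
    · exact .inl fun j => congrFun h j
    · obtain ⟨d, hd, hsd⟩ := exists_valuation_sum_eq v hx hx0 h
      refine .inr fun h0 => hd ?_
      have h1 : v (s q) = v (algebraMap F L d) := hsd
      rw [h0, v.map_zero, eq_comm, valuation_eq_top_iff] at h1
      exact (algebraMap F L).injective (by rw [h1, map_zero])
  rintro ⟨q, j⟩
  by_contra hne
  have hsq : s q ≠ 0 := (hzero q).resolve_left fun h => hne (h j)
  set w := (valuationRing v).valuation
  obtain ⟨q₀, -, hq₀⟩ := Finset.exists_max_image Finset.univ (fun q => w (y q * s q))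
    ⟨q, Finset.mem_univ _⟩
  have hpos : 0 < w (y q₀ * s q₀) :=
    ((Valuation.pos_iff w).2 (mul_ne_zero (hy0 q) hsq)).trans_le (hq₀ q (Finset.mem_univ _))
  have hval : ∀ r, s r ≠ 0 → ∃ d : F, d ≠ 0 ∧ v (s r) = v (algebraMap F L d) := by
    intro r hr
    refine exists_valuation_sum_eq v hx hx0 fun h => hr ?_
    refine Finset.sum_eq_zero fun j _ => ?_
    have : c (r, j) = 0 := congrFun h j
    rw [this, map_zero, zero_mul]
  have hlt : w (∑ r ∈ Finset.univ.erase q₀, y r * s r) < w (y q₀ * s q₀) := by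
    refine Valuation.map_sum_lt w hpos.ne' fun r hr => ?_
    refine lt_of_le_of_ne (hq₀ r (Finset.mem_univ _)) fun heq => (Finset.ne_of_mem_erase hr) ?_
    have hs0 : s q₀ ≠ 0 := right_ne_zero_of_mul ((Valuation.pos_iff w).1 hpos)
    have hsr : s r ≠ 0 := by
      rw [← heq] at hpos
      exact right_ne_zero_of_mul ((Valuation.pos_iff w).1 hpos)
    obtain ⟨d₀, hd₀, h₀⟩ := hval q₀ hs0
    obtain ⟨d, hd, h⟩ := hval r hsr
    have heq' : v (y r * s r) = v (y q₀ * s q₀) :=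
      le_antisymm ((valuation_valuationRing_le_iff v).1 heq.ge)
        ((valuation_valuationRing_le_iff v).1 heq.le)
    refine hy r q₀ (d₀ / d) (div_ne_zero hd₀ hd) ?_
    have hdL : algebraMap F L d ≠ 0 := (_root_.map_ne_zero _).2 hd
    have e1 : v (algebraMap F L d * y r) = v (algebraMap F L d₀ * y q₀) := by
      rw [v.map_mul, v.map_mul, ← h, ← h₀, ← v.map_mul, ← v.map_mul, mul_comm, heq', mul_comm]
    have e2 : y r = (algebraMap F L d)⁻¹ * (algebraMap F L d * y r) := by field_simp
    have e3 : algebraMap F L (d₀ / d) * y q₀ =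
        (algebraMap F L d)⁻¹ * (algebraMap F L d₀ * y q₀) := by
      rw [map_div₀]; field_simp
    rw [e2, e3, v.map_mul _ (algebraMap F L d * y r), e1, ← v.map_mul]
  rw [← Finset.add_sum_erase _ _ (Finset.mem_univ q₀), add_eq_zero_iff_neg_eq] at hsum
  rw [← hsum, Valuation.map_neg] at hlt
  exact hlt.false

variable (F) in
/-- The residue field of `F`, as a subfield of the residue field of `L`. -/
noncomputable def residueSubfield (v : AddValuation L (WithTop Γ)) : Subfield (residueField v) :=
  (residueMap F v).fieldRange

theorem mem_residueSubfield (v : AddValuation L (WithTop Γ)) {r : residueField v} :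
    r ∈ residueSubfield F v ↔ ∃ (x : F) (hx : 0 ≤ v (algebraMap F L x)),
      IsLocalRing.residue (valuationRing v) ⟨algebraMap F L x, hx⟩ = r := by
  constructor
  · rintro ⟨y, rfl⟩
    obtain ⟨x, rfl⟩ := IsLocalRing.residue_surjective y
    exact ⟨x, x.2, rfl⟩
  · rintro ⟨x, hx, rfl⟩
    exact ⟨IsLocalRing.residue _ ⟨x, hx⟩, rfl⟩

theorem residue_eq_zero_iff (v : AddValuation L (WithTop Γ)) (x : valuationRing v) :
    IsLocalRing.residue (valuationRing v) x = 0 ↔ 0 < v (x : L) := by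
  rw [residue_eq_zero_iff_valuation_lt_one, ← map_one (valuationRing v).valuation,
    valuation_valuationRing_lt_iff, v.map_one]

end FundamentalInequality

/-! ### The fundamental inequality between intermediate fields -/

section Layers

variable {K L Γ : Type*} [Field K] [Field L] [Algebra K L]
  [AddCommGroup Γ] [LinearOrder Γ] [IsOrderedAddMonoid Γ]

theorem valueGroup_mono (v : AddValuation L (WithTop Γ)) {E E' : IntermediateField K L}
    (h : E ≤ E') : valueGroup (restrict E v) ≤ valueGroup (restrict E' v) := by
  rintro γ ⟨x, hx⟩
  exact ⟨⟨x, h x.2⟩, hx⟩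

theorem residueSubfield_mono (v : AddValuation L (WithTop Γ)) {E E' : IntermediateField K L}
    (h : E ≤ E') : residueSubfield E v ≤ residueSubfield E' v := by
  intro r hr
  obtain ⟨x, hx, rfl⟩ := (mem_residueSubfield v).1 hr
  exact (mem_residueSubfield v).2 ⟨⟨x, h x.2⟩, hx, rfl⟩

/-- The fundamental inequality. -/
theorem relIndex_mul_relfinrank_le [FiniteDimensional K L] (v : AddValuation L (WithTop Γ))
    {E E' : IntermediateField K L} (h : E ≤ E') :
    (valueGroup (restrict E v)).relIndex (valueGroup (restrict E' v)) *
      (residueSubfield E v).relfinrank (residueSubfield E' v) ≤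
        IntermediateField.relfinrank E E' := by
  have hR := residueSubfield_mono v h
  -- An infinite index or degree counts as `0`, which makes the inequality trivial.
  rcases Nat.eq_zero_or_pos
    ((valueGroup (restrict E v)).relIndex (valueGroup (restrict E' v))) with he | he
  · rw [he, zero_mul]; exact Nat.zero_le _
  rcases Nat.eq_zero_or_pos
    ((residueSubfield E v).relfinrank (residueSubfield E' v)) with hf | hf
  · rw [hf, mul_zero]; exact Nat.zero_le _
  let Q := valueGroup (restrict E' v) ⧸
    (valueGroup (restrict E v)).addSubgroupOf (valueGroup (restrict E' v))
  have : ((valueGroup (restrict E v)).addSubgroupOf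
    (valueGroup (restrict E' v))).FiniteIndex := ⟨he.ne'⟩
  have : Finite Q := AddSubgroup.finite_quotient_of_finiteIndex
  let _ : Fintype Q := Fintype.ofFinite Q
  have hQ : Fintype.card Q =
      (valueGroup (restrict E v)).relIndex (valueGroup (restrict E' v)) := by
    rw [← Nat.card_eq_fintype_card]; rfl
  have hγ : ∀ q : Q, ∃ y : E', v (y : L) = ((q.out : valueGroup (restrict E' v)) : Γ) :=
    fun q => q.out.2
  choose y hy using hγ
  rw [Subfield.relfinrank_eq_finrank_of_le hR] at hf ⊢
  have : Module.Finite (residueSubfield E v) (Subfield.extendScalars hR) :=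
    Module.finite_of_finrank_pos hf
  let b := Module.finBasis (residueSubfield E v) (Subfield.extendScalars hR)
  have hb : ∀ j, ∃ (x : E') (hx : 0 ≤ v (x : L)),
      IsLocalRing.residue (valuationRing v) ⟨x, hx⟩ = (b j : residueField v) :=
    fun j => (mem_residueSubfield v).1 (b j).2
  choose x hx0 hx using hb
  have hli := linearIndependent_mul_of_valuation (F := E) v (x := fun j => (x j : L))
    (y := fun q => (y q : L)) ?_ hx0 ?_ ?_
  · let z : Q × Fin _ → IntermediateField.extendScalars h := fun i => y i.1 * x i.2
    have hz : LinearIndependent E z :=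
      LinearIndependent.of_comp (IntermediateField.extendScalars h).val.toLinearMap hli
    have : FiniteDimensional E L := FiniteDimensional.right K E L
    have hcard := hz.fintype_card_le_finrank
    rwa [Fintype.card_prod, hQ, Fintype.card_fin,
      ← IntermediateField.relfinrank_eq_finrank_of_le h] at hcard
  · intro c hc hpos j
    have hbli := Fintype.linearIndependent_iff.1 b.linearIndependent
    let g : Fin _ → residueSubfield E v := fun j =>
      ⟨IsLocalRing.residue (valuationRing v) ⟨algebraMap E L (c j), hc j⟩,
        (mem_residueSubfield v).2 ⟨_, hc j, rfl⟩⟩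
    have hg := hbli g ?_ j
    · exact (residue_eq_zero_iff v _).1 (congrArg Subtype.val hg)
    · refine Subtype.ext ?_
      let t : valuationRing v := ∑ j, ⟨algebraMap E L (c j), hc j⟩ * ⟨x j, hx0 j⟩
      have ht : ((t : valuationRing v) : L) = ∑ j, algebraMap E L (c j) * x j := by
        simp [t]
      have h1 : IsLocalRing.residue (valuationRing v) t = 0 :=
        (residue_eq_zero_iff v t).2 (ht ▸ hpos)
      rw [map_sum] at h1
      rw [AddSubmonoidClass.coe_finsetSum]
      change _ = (0 : residueField v)
      rw [← h1]
      refine Finset.sum_congr rfl fun j _ => ?_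
      rw [map_mul, hx]
      rfl
  · intro q h0
    have h1 := hy q
    rw [h0, v.map_zero] at h1
    exact WithTop.coe_ne_top h1.symm
  · intro q r d hd hqr
    rw [v.map_mul, hy, hy] at hqr
    obtain ⟨δ, hδ⟩ := exists_coe_eq v ((_root_.map_ne_zero (algebraMap E L)).2 hd)
    rw [hδ, ← WithTop.coe_add, WithTop.coe_inj] at hqr
    have h1 : (q.out : valueGroup (restrict E' v)) - r.out ∈
        (valueGroup (restrict E v)).addSubgroupOf (valueGroup (restrict E' v)) := by
      rw [AddSubgroup.mem_addSubgroupOf, AddSubgroup.coe_sub, hqr, add_sub_cancel_right]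
      exact ⟨d, hδ⟩
    rw [← QuotientAddGroup.out_eq' q, ← QuotientAddGroup.out_eq' r]
    exact (QuotientAddGroup.eq_iff_sub_mem.2 h1)

end Layers

/-! ### Distances as cuts and their shifts -/

section Distances

variable {K L Γ : Type*} [Field K] [Field L] [Algebra K L]
  [AddCommGroup Γ] [LinearOrder Γ] [IsOrderedAddMonoid Γ]

theorem Represents.le_iff {v : AddValuation L (WithTop Γ)} {q r : DivHull K v} {γ δ : Γ}
    (hq : Represents K v q γ) (hr : Represents K v r δ) : q ≤ r ↔ γ ≤ δ := by
  obtain ⟨n, α, hα, rfl⟩ := hq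
  obtain ⟨m, β, hβ, rfl⟩ := hr
  rw [DivisibleHull.mk_le_mk, ← Subtype.coe_le_coe, AddSubgroup.coe_nsmul, AddSubgroup.coe_nsmul,
    hα, hβ, smul_smul, smul_smul, mul_comm (n : ℕ)]
  exact nsmul_le_nsmul_iff_right (mul_ne_zero m.ne_zero n.ne_zero)

theorem Represents.add {v : AddValuation L (WithTop Γ)} {q r : DivHull K v} {γ δ : Γ}
    (hq : Represents K v q γ) (hr : Represents K v r δ) : Represents K v (q + r) (γ + δ) := by
  obtain ⟨n, α, hα, rfl⟩ := hq
  obtain ⟨m, β, hβ, rfl⟩ := hr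
  refine ⟨n * m, (m : ℕ) • α + (n : ℕ) • β, ?_, DivisibleHull.mk_add_mk⟩
  rw [AddSubgroup.coe_add, AddSubgroup.coe_nsmul, AddSubgroup.coe_nsmul, hα, hβ, smul_smul,
    smul_smul, PNat.mul_coe, smul_add, mul_comm (m : ℕ)]

theorem represents_coe (v : AddValuation L (WithTop Γ)) (α : valueGroup (restrict K v)) :
    Represents K v (α : DivHull K v) (α : Γ) :=
  ⟨1, α, by simp, rfl⟩

/-- A finite index makes `vL / vK` torsion, so the intersection with the divisible hull in `dist`
loses no finite value. -/
theorem exists_represents {v : AddValuation L (WithTop Γ)} (hidx : ramificationIndex K v ≠ 0)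
    {x : L} {γ : Γ} (hx : v x = (γ : WithTop Γ)) : ∃ q, Represents K v q γ := by
  obtain ⟨n, hn, -, hmem⟩ := AddSubgroup.exists_nsmul_mem_of_relIndex_ne_zero hidx
    (show γ ∈ valueGroup v from ⟨x, hx⟩)
  exact ⟨_, ⟨n, hn⟩, ⟨_, hmem.1⟩, rfl, rfl⟩

variable (K) in
/-- The sets `v (b - K)` and `v z + v (a - K)` generate the same initial segment. -/
def IsShift (v : AddValuation L (WithTop Γ)) (z b a : L) : Prop :=
  (∀ c : K, ∃ c' : K, v (b - algebraMap K L c) ≤ v (z * (a - algebraMap K L c'))) ∧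
    ∀ c : K, ∃ c' : K, v (z * (a - algebraMap K L c)) ≤ v (b - algebraMap K L c')

/-- Comparison through the common `a`: the shift from `b'` to `b` is the difference of the values of
`z` and `z'`. When that difference lies in `vK`, one of the two elements can represent the other. -/
theorem IsShift.comp_symm {v : AddValuation L (WithTop Γ)} {z z' k a b b' : L} (hz' : z' ≠ 0)
    (h : IsShift K v z b a) (h' : IsShift K v z' b' a) (hk : v z = v (k * z')) :
    IsShift K v k b b' := by
  have key : ∀ x y, v (z' * x) ≤ v y → v (z * x) ≤ v (k * y) := by
    intro x y hxy
    rw [v.map_mul, hk, v.map_mul, add_assoc, ← v.map_mul, v.map_mul k y]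
    exact add_le_add_right hxy _
  have hz : v z' ≠ ⊤ := fun h0 => hz' ((valuation_eq_top_iff v).1 h0)
  have key' : ∀ x y, v y ≤ v (z' * x) → v (k * y) ≤ v (z * x) := by
    intro x y hxy
    rw [v.map_mul z, hk, v.map_mul, v.map_mul k, add_assoc, ← v.map_mul z']
    exact add_le_add_right hxy _
  refine ⟨fun c => ?_, fun c => ?_⟩
  · obtain ⟨c₁, h₁⟩ := h.1 c
    obtain ⟨c₂, h₂⟩ := h'.2 c₁
    exact ⟨c₂, h₁.trans (key _ _ h₂)⟩
  · obtain ⟨c₁, h₁⟩ := h'.1 c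
    obtain ⟨c₂, h₂⟩ := h.2 c₁
    exact ⟨c₂, (key' _ _ h₁).trans h₂⟩

theorem IsShift.of_eq {v : AddValuation L (WithTop Γ)} {z b b' a : L} (h : IsShift K v z b' a)
    (hb : ∀ c : K, v (b - algebraMap K L c) = v (b' - algebraMap K L c)) : IsShift K v z b a := by
  simpa only [IsShift, hb] using h

open scoped Pointwise in
theorem IsShift.dist_eq {v : AddValuation L (WithTop Γ)} (hidx : ramificationIndex K v ≠ 0)
    {z b a : L} (h : IsShift K v z b a) (ha : a ∉ Set.range (algebraMap K L))
    (hb : b ∉ Set.range (algebraMap K L)) {γ : Γ} (hz : v z = (γ : WithTop Γ)) {q : DivHull K v}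
    (hq : Represents K v q γ) : dist K v b = q +ᵥ dist K v a := by
  have hne : ∀ {x : L}, x ∉ Set.range (algebraMap K L) → ∀ c : K,
      ∃ δ : Γ, v (x - algebraMap K L c) = (δ : WithTop Γ) := by
    intro x hx c
    exact exists_coe_eq v fun h0 => hx ⟨c, (sub_eq_zero.1 h0).symm⟩
  ext r
  constructor
  · rintro ⟨s, ⟨δ, ⟨c, hc⟩, hs⟩, hrs⟩
    obtain ⟨c', hc'⟩ := h.1 c
    obtain ⟨ε, hε⟩ := hne ha c'
    obtain ⟨t, ht⟩ := exists_represents hidx hε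
    refine ⟨r - q, ⟨t, ⟨ε, ⟨c', hε⟩, ht⟩, ?_⟩, add_sub_cancel q r⟩
    rw [sub_le_iff_le_add']
    refine hrs.trans ((hs.le_iff (hq.add ht)).2 ?_)
    rw [v.map_mul, hz, hε] at hc'
    have hc'' : v (b - algebraMap K L c) = (δ : WithTop Γ) := hc
    rw [hc''] at hc'
    exact_mod_cast hc'
  · rintro ⟨y, ⟨t, ⟨ε, ⟨c, hc⟩, ht⟩, hyt⟩, rfl⟩
    obtain ⟨c', hc'⟩ := h.2 c
    obtain ⟨δ, hδ⟩ := hne hb c'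
    obtain ⟨s, hs⟩ := exists_represents hidx hδ
    refine ⟨s, ⟨δ, ⟨c', hδ⟩, hs⟩, (add_le_add_right hyt q).trans
      (((hq.add ht).le_iff hs).2 ?_)⟩
    have hc'' : v (a - algebraMap K L c) = (ε : WithTop Γ) := hc
    rw [v.map_mul, hz, hc'', hδ] at hc'
    exact_mod_cast hc'

variable (K) in
/-- The elements whose distances are counted by `ndd` and `nddStar`. -/
def limitElements (v : AddValuation L (WithTop Γ)) : Set L :=
  {b | b ∉ Set.range (algebraMap K L) ∧ IsWeaklyImmediate K v b}

theorem IsWeaklyImmediate.exists_lt {v : AddValuation L (WithTop Γ)} {b : L}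
    (hb : IsWeaklyImmediate K v b) (c : K) :
    ∃ c' : K, v (b - algebraMap K L c) < v (b - algebraMap K L c') := by
  by_contra! h
  refine hb ⟨v (b - algebraMap K L c), ⟨c, rfl⟩, ?_⟩
  rintro _ ⟨c', rfl⟩
  exact h c'

theorem isWeaklyImmediate_of_eq {v : AddValuation L (WithTop Γ)} {b b' : L}
    (hb : IsWeaklyImmediate K v b)
    (h : ∀ c : K, v (b - algebraMap K L c) = v (b' - algebraMap K L c)) :
    IsWeaklyImmediate K v b' := by
  rwa [IsWeaklyImmediate, valuesOfDifferences, ← funext h]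

/-- An element of `K` attains the value `⊤` and so is never weakly immediate. -/
theorem mem_limitElements_iff {v : AddValuation L (WithTop Γ)} {b : L} :
    b ∈ limitElements K v ↔ IsWeaklyImmediate K v b := by
  refine ⟨fun h => h.2, fun h => ⟨?_, h⟩⟩
  rintro ⟨c, rfl⟩
  obtain ⟨c', hc'⟩ := h.exists_lt c
  rw [sub_self, v.map_zero] at hc'
  exact not_top_lt hc'

/-- `Z` supplies the admissible shifts: nonzero elements of `K` for `ndd`, of `L` for `nddStar`. -/
theorem numDistances_le {v : AddValuation L (WithTop Γ)} (hidx : ramificationIndex K v ≠ 0)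
    {H : AddSubgroup (DivHull K v)} {Z : Set L}
    (hZ : ∀ z ∈ Z, ∃ γ : Γ, v z = (γ : WithTop Γ) ∧ ∃ q ∈ H, Represents K v q γ)
    {S : Finset L} (hS : ↑S ⊆ limitElements K v)
    (hcov : ∀ b ∈ limitElements K v, ∃ a ∈ S, ∃ z ∈ Z, IsShift K v z b a) :
    numDistances K v H ≤ S.card := by
  refine iInf₂_le S.card ⟨fun i => S.equivFin.symm i, fun i => hS (S.equivFin.symm i).2, ?_⟩
  intro b hb hbw
  obtain ⟨a, ha, z, hz, hshift⟩ := hcov b ⟨hb, hbw⟩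
  obtain ⟨γ, hγ, q, hq, hrep⟩ := hZ z hz
  refine ⟨S.equivFin ⟨a, ha⟩, q, hq, ?_⟩
  simp only [Equiv.symm_apply_apply]
  exact hshift.dist_eq hidx (hS ha).1 hb hγ hrep

end Distances

/-! ### Attributing distances to layers of the tower -/

section Layers

variable {K L Γ : Type*} [Field K] [Field L] [Algebra K L]
  [AddCommGroup Γ] [LinearOrder Γ] [IsOrderedAddMonoid Γ]

/-- The elements of `E' \ E` which are weakly immediate over `K` and whose distance from `K` is
the distance from `E`. -/
def layerElements (v : AddValuation L (WithTop Γ)) (E E' : IntermediateField K L) : Set L :=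
  {b | b ∈ E' ∧ b ∉ E ∧ IsWeaklyImmediate K v b ∧
    ∀ y ∈ E, ∃ c : K, v (b - y) ≤ v (b - algebraMap K L c)}

/-- A weakly immediate element of `E'` that does not belong to `layerElements v E E'` has the
same distance as some element of `E`. -/
theorem exists_forall_valuation_eq {v : AddValuation L (WithTop Γ)} {E E' : IntermediateField K L}
    {b : L} (hb : b ∈ E') (hbK : IsWeaklyImmediate K v b) (hbl : b ∉ layerElements v E E') :
    ∃ y ∈ E, ∀ c : K, v (b - algebraMap K L c) = v (y - algebraMap K L c) := by
  by_cases hbE : b ∈ E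
  · exact ⟨b, hbE, fun _ => rfl⟩
  have : ∃ y ∈ E, ∀ c : K, v (b - algebraMap K L c) < v (b - y) := by
    by_contra! h
    exact hbl ⟨hb, hbE, hbK, h⟩
  obtain ⟨y, hy, h⟩ := this
  refine ⟨y, hy, fun c => ?_⟩
  -- As `b` is closer to `y` than to `K`, the ultrametric inequality gives `b` and `y` equal
  -- distance from each `c`.
  have h1 : y - algebraMap K L c = (b - algebraMap K L c) - (b - y) := by ring
  rw [h1]
  have h2 := Valuation.map_sub_eq_of_lt_left (valuationRing v).valuation
    ((valuation_valuationRing_lt_iff v).2 (h c))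
  exact le_antisymm ((valuation_valuationRing_le_iff v).1 h2.le)
    ((valuation_valuationRing_le_iff v).1 h2.ge)

theorem noBestApproximation_of_mem_layerElements {v : AddValuation L (WithTop Γ)}
    {E E' : IntermediateField K L} {a : L} (ha : a ∈ layerElements v E E') :
    NoBestApproximation E (valuationRing v).valuation a := by
  intro y
  obtain ⟨c, hc⟩ := ha.2.2.2 y y.2
  obtain ⟨c', hc'⟩ := ha.2.2.1.exists_lt c
  exact ⟨algebraMap K E c', (valuation_valuationRing_lt_iff v).2 (hc.trans_lt hc')⟩

theorem minpoly_natDegree_and_mem_adjoin [FiniteDimensional K L] {E E' : IntermediateField K L}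
    (hEE' : E ≤ E') {p : ℕ} (hp : p.Prime) (hdeg : IntermediateField.relfinrank E E' = p) {a : L}
    (ha : a ∈ E') (haE : a ∉ E) :
    (minpoly E a).natDegree = p ∧ ∀ b ∈ E', b ∈ IntermediateField.adjoin E {a} := by
  have : FiniteDimensional E L := FiniteDimensional.right K E L
  set M := IntermediateField.extendScalars hEE'
  have hM : Module.finrank E M = p := by
    rw [← IntermediateField.relfinrank_eq_finrank_of_le hEE', hdeg]
  have hint : IsIntegral E a := Algebra.IsIntegral.isIntegral a
  have hle : IntermediateField.adjoin E {a} ≤ M := by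
    rw [IntermediateField.adjoin_simple_le_iff]
    exact ha
  have hdvd : (minpoly E a).natDegree ∣ p := by
    rw [← IntermediateField.adjoin.finrank hint, ← hM]
    exact Dvd.intro _ (IntermediateField.finrank_bot_mul_relfinrank hle)
  have hne : (minpoly E a).natDegree ≠ 1 := by
    intro h1
    obtain ⟨y, hy⟩ := minpoly.natDegree_eq_one_iff.1 h1
    exact haE (hy ▸ y.2)
  have heq := (hp.eq_one_or_self_of_dvd _ hdvd).resolve_left hne
  refine ⟨heq, fun b hb => ?_⟩
  have h2 : IntermediateField.adjoin E {a} = M := by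
    refine IntermediateField.eq_of_le_of_finrank_eq hle ?_
    rw [IntermediateField.adjoin.finrank hint, heq, hM]
  rw [h2]
  exact hb

end Layers

/-! ### Layers of prime degree, counting, and induction along the tower -/

section PrimeLayers

variable {K L Γ : Type*} [Field K] [Field L] [Algebra K L]
  [AddCommGroup Γ] [LinearOrder Γ] [IsOrderedAddMonoid Γ]

/-- `E' = E(a)`, so the distances of `a` and `b` from `E` agree up to a value of `E`. For layer
elements `K` approximates as well as `E`, so this passes to `K`. -/
theorem exists_isShift_of_mem_layerElements [FiniteDimensional K L]
    {v : AddValuation L (WithTop Γ)} (huv : IsUV K v) {E E' : IntermediateField K L}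
    (hEE' : E ≤ E') {p : ℕ} (hp : p.Prime) (hdeg : IntermediateField.relfinrank E E' = p)
    (hpv : ∀ j : ℕ, 0 < j → j < p → (valuationRing v).valuation (j : L) = 1) {a b : L}
    (ha : a ∈ layerElements v E E') (hb : b ∈ layerElements v E E') :
    ∃ z ∈ E, z ≠ 0 ∧ IsShift K v z b a := by
  have : FiniteDimensional E L := FiniteDimensional.right K E L
  obtain ⟨hmin, hadj⟩ := minpoly_natDegree_and_mem_adjoin hEE' hp hdeg ha.1 ha.2.1
  obtain ⟨z, hz, h1, h2⟩ := exists_mul_cofinal (huv.minpolyIntegral E)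
    (noBestApproximation_of_mem_layerElements ha) (by rwa [hmin]) (hadj b hb.1)
    (by rintro ⟨y, rfl⟩; exact hb.2.1 y.2)
  simp only [valuation_valuationRing_le_iff] at h1 h2
  refine ⟨z, z.2, fun h0 => hz (Subtype.ext h0), fun c => ?_, fun c => ?_⟩
  · obtain ⟨y, hy⟩ := h1 (algebraMap K E c)
    obtain ⟨c', hc'⟩ := ha.2.2.2 y y.2
    refine ⟨c', le_trans hy ?_⟩
    rw [v.map_mul, v.map_mul]
    exact add_le_add_right hc' _
  · obtain ⟨y, hy⟩ := h2 (algebraMap K E c)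
    obtain ⟨c', hc'⟩ := hb.2.2.2 y y.2
    exact ⟨c', hy.trans hc'⟩

theorem exists_valuation_lt_of_mem_layerElements [FiniteDimensional K L]
    {v : AddValuation L (WithTop Γ)} (huv : IsUV K v) {E E' : IntermediateField K L}
    (hEE' : E ≤ E') {p : ℕ} (hp : p.Prime) (hdeg : IntermediateField.relfinrank E E' = p)
    (hpv : ∀ j : ℕ, 0 < j → j < p → (valuationRing v).valuation (j : L) = 1) {a : L}
    (ha : a ∈ layerElements v E E') {x : L} (hx : x ∈ E') (hx0 : x ≠ 0) :
    ∃ c : E, v x < v (x - c) := by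
  have : FiniteDimensional E L := FiniteDimensional.right K E L
  obtain ⟨hmin, hadj⟩ := minpoly_natDegree_and_mem_adjoin hEE' hp hdeg ha.1 ha.2.1
  obtain ⟨c, hc⟩ := exists_valuation_sub_lt (huv.minpolyIntegral E)
    (noBestApproximation_of_mem_layerElements ha) (by rwa [hmin]) (hadj x hx) hx0
  exact ⟨c, (valuation_valuationRing_lt_iff v).1 hc⟩

theorem valuation_eq_of_lt_sub (v : AddValuation L (WithTop Γ)) {x y : L} (h : v x < v (x - y)) :
    v y = v x := by
  have h1 : (valuationRing v).valuation (y - x) < (valuationRing v).valuation x := by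
    rw [Valuation.map_sub_swap]
    exact (valuation_valuationRing_lt_iff v).2 h
  have h2 := Valuation.map_eq_of_sub_lt (valuationRing v).valuation h1
  exact le_antisymm ((valuation_valuationRing_le_iff v).1 h2.ge)
    ((valuation_valuationRing_le_iff v).1 h2.le)

theorem valueGroup_le_of_forall_exists_lt (v : AddValuation L (WithTop Γ))
    {E E' : IntermediateField K L} (h : ∀ x ∈ E', x ≠ 0 → ∃ c : E, v x < v (x - c)) :
    valueGroup (restrict E' v) ≤ valueGroup (restrict E v) := by
  rintro γ ⟨x, hx⟩
  have hx' : v (x : L) = (γ : WithTop Γ) := hx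
  have hx0 : (x : L) ≠ 0 := by
    intro h0
    rw [h0, v.map_zero] at hx'
    exact WithTop.coe_ne_top hx'.symm
  obtain ⟨c, hc⟩ := h x x.2 hx0
  exact ⟨c, (valuation_eq_of_lt_sub v hc).trans hx'⟩

theorem residueSubfield_le_of_forall_exists_lt (v : AddValuation L (WithTop Γ))
    {E E' : IntermediateField K L} (h : ∀ x ∈ E', x ≠ 0 → ∃ c : E, v x < v (x - c)) :
    residueSubfield E' v ≤ residueSubfield E v := by
  intro r hr
  obtain ⟨x, hx, rfl⟩ := (mem_residueSubfield v).1 hr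
  by_cases hx0 : (x : L) = 0
  · have : (⟨algebraMap E' L x, hx⟩ : valuationRing v) = 0 := Subtype.ext hx0
    rw [this, map_zero]
    exact zero_mem _
  obtain ⟨c, hc⟩ := h x x.2 hx0
  have hvc : 0 ≤ v (algebraMap E L c) := hx.trans_eq (valuation_eq_of_lt_sub v hc).symm
  refine (mem_residueSubfield v).2 ⟨c, hvc, ?_⟩
  rw [eq_comm, ← sub_eq_zero, ← map_sub, residue_eq_zero_iff]
  exact hx.trans_lt hc

/-- The elements of `S` represent, up to shifts by values of elements of `Z`, the distances of all
elements of `E` that are weakly immediate over `K`. -/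
def Covers (v : AddValuation L (WithTop Γ)) (Z : Set L) (E : IntermediateField K L)
    (S : Finset L) : Prop :=
  ↑S ⊆ limitElements K v ∧ ∀ b ∈ E, b ∈ limitElements K v → ∃ a ∈ S, ∃ z ∈ Z, IsShift K v z b a

open Classical in
theorem Covers.union {v : AddValuation L (WithTop Γ)} {Z : Set L} {E E' : IntermediateField K L}
    {S T : Finset L} (hS : Covers v Z E S) (hT : ↑T ⊆ layerElements v E E')
    (hcov : ∀ b ∈ layerElements v E E', ∃ a ∈ T, ∃ z ∈ Z, IsShift K v z b a) :
    Covers v Z E' (S ∪ T) := by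
  refine ⟨?_, fun b hb hbK => ?_⟩
  · rw [Finset.coe_union, Set.union_subset_iff]
    exact ⟨hS.1, fun a ha => mem_limitElements_iff.2 (hT ha).2.2.1⟩
  · by_cases hbl : b ∈ layerElements v E E'
    · obtain ⟨a, ha, h⟩ := hcov b hbl
      exact ⟨a, Finset.mem_union_right _ ha, h⟩
    · obtain ⟨y, hy, hby⟩ := exists_forall_valuation_eq hb hbK.2 hbl
      obtain ⟨a, ha, z, hz, h⟩ := hS.2 y hy
        (mem_limitElements_iff.2 (isWeaklyImmediate_of_eq hbK.2 hby))
      exact ⟨a, Finset.mem_union_left _ ha, z, hz, h.of_eq hby⟩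

/-- Relative to a fixed `a`, each layer element has a shift in `vE`. Elements whose shifts are
congruent modulo `vK` represent each other, so one per occurring coset suffices. -/
theorem exists_finset_layerElements [FiniteDimensional K L]
    {v : AddValuation L (WithTop Γ)} (huv : IsUV K v) {E E' : IntermediateField K L}
    (hEE' : E ≤ E') {p : ℕ} (hp : p.Prime) (hdeg : IntermediateField.relfinrank E E' = p)
    (hpv : ∀ j : ℕ, 0 < j → j < p → (valuationRing v).valuation (j : L) = 1)
    (hidx : (valueGroup (restrict K v)).relIndex (valueGroup (restrict E v)) ≠ 0) :
    ∃ T : Finset L,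
      T.card ≤ (valueGroup (restrict K v)).relIndex (valueGroup (restrict E v)) ∧
      ↑T ⊆ layerElements v E E' ∧ ∀ b ∈ layerElements v E E', ∃ a ∈ T,
        ∃ z ∈ algebraMap K L '' {0}ᶜ, IsShift K v z b a := by
  classical
  rcases (layerElements v E E').eq_empty_or_nonempty with hempty | ⟨a, ha⟩
  · exact ⟨∅, Nat.zero_le _, by simp, by simp [hempty]⟩
  let Q := valueGroup (restrict E v) ⧸
    (valueGroup (restrict K v)).addSubgroupOf (valueGroup (restrict E v))
  have : ((valueGroup (restrict K v)).addSubgroupOf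
    (valueGroup (restrict E v))).FiniteIndex := ⟨hidx⟩
  have : Finite Q := AddSubgroup.finite_quotient_of_finiteIndex
  have hz := fun b : layerElements v E E' =>
    exists_isShift_of_mem_layerElements huv hEE' hp hdeg hpv ha b.2
  choose z hzE hz0 hz using hz
  choose γ hγ using fun b => exists_coe_eq v (hz0 b)
  let φ : layerElements v E E' → Q := fun b =>
    QuotientAddGroup.mk (⟨γ b, ⟨⟨z b, hzE b⟩, hγ b⟩⟩ : valueGroup (restrict E v))
  let _ : Fintype (Set.range φ) := Fintype.ofFinite _
  refine ⟨Finset.univ.image fun q : Set.range φ => ((Set.rangeSplitting φ q : layerElements v E E') : L), ?_, ?_, ?_⟩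
  · refine Finset.card_image_le.trans ?_
    rw [Finset.card_univ, ← Nat.card_eq_fintype_card]
    exact Nat.card_le_card_of_injective (Subtype.val : Set.range φ → Q) Subtype.val_injective
  · intro x hx
    obtain ⟨q, -, rfl⟩ := Finset.mem_image.1 hx
    exact Subtype.property _
  · intro b hb
    set q : Set.range φ := ⟨φ ⟨b, hb⟩, ⟨_, rfl⟩⟩
    set b' := Set.rangeSplitting φ q
    refine ⟨b', Finset.mem_image_of_mem _ (Finset.mem_univ q), ?_⟩
    have hφ : φ b' = φ ⟨b, hb⟩ := Set.apply_rangeSplitting φ q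
    have hmem := QuotientAddGroup.eq_iff_sub_mem.1 hφ.symm
    rw [AddSubgroup.mem_addSubgroupOf] at hmem
    obtain ⟨k, hk⟩ := hmem
    have hk' : v (algebraMap K L k) = ((γ ⟨b, hb⟩ - γ b' : Γ) : WithTop Γ) := hk
    have hk0 : k ≠ 0 := by
      rintro rfl
      rw [map_zero, v.map_zero] at hk'
      exact WithTop.coe_ne_top hk'.symm
    refine ⟨_, ⟨k, hk0, rfl⟩, (hz ⟨b, hb⟩).comp_symm (hz0 b') (hz b') ?_⟩
    rw [v.map_mul, hk', hγ, hγ, ← WithTop.coe_add, sub_add_cancel]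

theorem valueGroup_restrict_bot (v : AddValuation L (WithTop Γ)) :
    valueGroup (restrict (⊥ : IntermediateField K L) v) = valueGroup (restrict K v) := by
  ext γ
  constructor
  · rintro ⟨⟨x, hx⟩, hxγ⟩
    obtain ⟨c, rfl⟩ := IntermediateField.mem_bot.1 hx
    exact ⟨c, hxγ⟩
  · rintro ⟨c, hc⟩
    exact ⟨algebraMap K _ c, hc⟩

theorem valueGroup_restrict_top (v : AddValuation L (WithTop Γ)) :
    valueGroup (restrict (⊤ : IntermediateField K L) v) = valueGroup v := by
  ext γ
  exact ⟨fun ⟨x, hx⟩ => ⟨x, hx⟩, fun ⟨x, hx⟩ => ⟨⟨x, trivial⟩, hx⟩⟩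

theorem residueSubfield_bot (v : AddValuation L (WithTop Γ)) :
    residueSubfield (⊥ : IntermediateField K L) v = residueSubfield K v := by
  ext r
  rw [mem_residueSubfield, mem_residueSubfield]
  constructor
  · rintro ⟨⟨x, hx⟩, hxr⟩
    obtain ⟨c, rfl⟩ := IntermediateField.mem_bot.1 hx
    exact ⟨c, hxr⟩
  · rintro ⟨c, hc⟩
    exact ⟨algebraMap K _ c, hc⟩

theorem residueSubfield_top (v : AddValuation L (WithTop Γ)) :
    residueSubfield (⊤ : IntermediateField K L) v = ⊤ := by
  refine eq_top_iff.2 fun r _ => ?_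
  obtain ⟨x, rfl⟩ := IsLocalRing.residue_surjective r
  exact (mem_residueSubfield v).2 ⟨⟨x, trivial⟩, x.2, rfl⟩

theorem inertiaDegree_eq_relfinrank (v : AddValuation L (WithTop Γ)) :
    inertiaDegree K v = (residueSubfield K v).relfinrank ⊤ := by
  rw [Subfield.relfinrank_top_right]
  let _ := (residueMap K v).toAlgebra
  exact Algebra.finrank_eq_of_equiv_equiv (residueMap K v).rangeRestrictFieldEquiv
    (RingEquiv.refl (residueField v)) (by ext; rfl)

theorem valuation_natCast_eq_one (v : AddValuation L (WithTop Γ)) {j : ℕ}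
    (hj : (j : residueField (restrict K v)) ≠ 0) : (valuationRing v).valuation (j : L) = 1 := by
  have h1 : ¬ 0 < v (j : L) := by
    intro h
    refine hj ?_
    rw [← map_natCast (IsLocalRing.residue (valuationRing (restrict K v)))]
    refine (residue_eq_zero_iff (restrict K v) _).2 ?_
    change 0 < v (algebraMap K L ((j : valuationRing (restrict K v)) : K))
    simpa using h
  have h2 : (j : L) ∈ valuationRing v := natCast_mem _ j
  refine le_antisymm ((ValuationSubring.valuation_le_one_iff _ _).2 h2) ?_
  rw [← map_one (valuationRing v).valuation, valuation_valuationRing_le_iff, v.map_one]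
  exact not_lt.1 h1

/-- Here `t` counts the nonempty layers. Such a layer multiplies the degree by `p` without changing
value group or residue field; an empty one obeys the fundamental inequality and needs no new
representative. -/
theorem exists_covers_of_tower [FiniteDimensional K L]
    {v : AddValuation L (WithTop Γ)} (huv : IsUV K v) {p : ℕ} (hp : p.Prime)
    (hpv : ∀ j : ℕ, 0 < j → j < p → (valuationRing v).valuation (j : L) = 1)
    (hidx : ramificationIndex K v ≠ 0) {n : ℕ} {E : ℕ → IntermediateField K L} (h0 : E 0 = ⊥)
    (hE : ∀ i < n, E i ≤ E (i + 1) ∧ IntermediateField.relfinrank (E i) (E (i + 1)) = p)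
    (i : ℕ) (hi : i ≤ n) :
    ∃ (t : ℕ) (S T : Finset L),
      p ^ t * ((valueGroup (restrict K v)).relIndex (valueGroup (restrict (E i) v)) *
        (residueSubfield K v).relfinrank (residueSubfield (E i) v)) ≤ p ^ i ∧
      S.card ≤ t ∧ Covers v {0}ᶜ (E i) S ∧
      T.card ≤ t * ramificationIndex K v ∧ Covers v (algebraMap K L '' {0}ᶜ) (E i) T := by
  classical
  induction i with
  | zero =>
    refine ⟨0, ∅, ∅, ?_, le_rfl, ⟨?_, ?_⟩, Nat.zero_le _, ⟨?_, ?_⟩⟩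
    · rw [h0, valueGroup_restrict_bot, residueSubfield_bot, AddSubgroup.relIndex_self,
        Subfield.relfinrank_self]
      simp
    any_goals
      rw [Finset.coe_empty]
      exact Set.empty_subset _
    all_goals
      intro b hb hbK
      rw [h0] at hb
      exact absurd (IntermediateField.mem_bot.1 hb) hbK.1
  | succ i ih =>
    obtain ⟨t, S, T, hle, hSc, hS, hTc, hT⟩ := ih (by omega)
    obtain ⟨hEE', hdeg⟩ := hE i (by omega)
    have hV : valueGroup (restrict K v) ≤ valueGroup (restrict (E i) v) := by
      rw [← valueGroup_restrict_bot (K := K)]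
      exact valueGroup_mono v bot_le
    have hR : residueSubfield K v ≤ residueSubfield (E i) v := by
      rw [← residueSubfield_bot (K := K)]
      exact residueSubfield_mono v bot_le
    have hV' := valueGroup_mono v hEE'
    have hR' := residueSubfield_mono v hEE'
    have hVL : valueGroup (restrict (E i) v) ≤ valueGroup v := by
      rw [← valueGroup_restrict_top (K := K) v]
      exact valueGroup_mono (K := K) v le_top
    rcases (layerElements v (E i) (E (i + 1))).eq_empty_or_nonempty with hempty | ⟨a, ha⟩
    · refine ⟨t, S ∪ ∅, T ∪ ∅, ?_, by simpa, hS.union (by simp) (by simp [hempty]), by simpa,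
        hT.union (by simp) (by simp [hempty])⟩
      rw [← AddSubgroup.relIndex_mul_relIndex _ _ _ hV hV',
        ← Subfield.relfinrank_mul_relfinrank hR hR', mul_mul_mul_comm, ← mul_assoc, pow_succ]
      exact Nat.mul_le_mul hle (hdeg ▸ relIndex_mul_relfinrank_le v hEE')
    · have himm := fun x hx hx0 =>
        exists_valuation_lt_of_mem_layerElements huv hEE' hp hdeg hpv ha (x := x) hx hx0
      have hVeq := le_antisymm hV' (valueGroup_le_of_forall_exists_lt v himm)
      have hReq := le_antisymm hR' (residueSubfield_le_of_forall_exists_lt v himm)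
      have hidxE : (valueGroup (restrict K v)).relIndex (valueGroup (restrict (E i) v)) ≠ 0 :=
        fun h => hidx <| by
          rw [ramificationIndex, ← AddSubgroup.relIndex_mul_relIndex _ _ _ hV hVL, h, zero_mul]
      obtain ⟨U, hUc, hU, hUcov⟩ :=
        exists_finset_layerElements huv hEE' hp hdeg hpv hidxE
      refine ⟨t + 1, S ∪ {a}, T ∪ U, ?_, ?_, hS.union (by simpa) ?_, ?_, hT.union hU hUcov⟩
      · rw [← hVeq, ← hReq, pow_succ, pow_succ, mul_right_comm]
        exact Nat.mul_le_mul_right p hle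
      · exact (Finset.card_union_le _ _).trans (by simpa)
      · intro b hb
        obtain ⟨z, -, hz0, hz⟩ :=
          exists_isShift_of_mem_layerElements huv hEE' hp hdeg hpv ha hb
        exact ⟨a, Finset.mem_singleton_self a, z, hz0, hz⟩
      · refine (Finset.card_union_le _ _).trans ?_
        rw [Nat.succ_mul]
        exact Nat.add_le_add hTc
          (hUc.trans (AddSubgroup.relIndex_le_of_le_right hVL hidx))

theorem finrank_eq_pow_of_tower {p n : ℕ} {E : ℕ → IntermediateField K L} (h0 : E 0 = ⊥)
    (hn : E n = ⊤)
    (hE : ∀ i < n, E i ≤ E (i + 1) ∧ IntermediateField.relfinrank (E i) (E (i + 1)) = p) :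
    Module.finrank K L = p ^ n := by
  have key : ∀ i ≤ n, Module.finrank K (E i) = p ^ i := by
    intro i
    induction i with
    | zero => intro _; rw [h0, IntermediateField.finrank_bot, pow_zero]
    | succ i ih =>
      intro hi
      obtain ⟨hle, hdeg⟩ := hE i (by omega)
      rw [← IntermediateField.finrank_bot_mul_relfinrank hle, ih (by omega), hdeg, pow_succ]
  rw [← key n le_rfl, hn, IntermediateField.finrank_top']

/-- The defect formula without division. -/
theorem finrank_eq_of_defect_eq {v : AddValuation L (WithTop Γ)} {p m : ℕ} (hp : p ≠ 0)
    (h : defect K v = (p : ℚ) ^ m) :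
    ramificationIndex K v ≠ 0 ∧ inertiaDegree K v ≠ 0 ∧
      Module.finrank K L = p ^ m * (ramificationIndex K v * inertiaDegree K v) := by
  have hpm : (p : ℚ) ^ m ≠ 0 := pow_ne_zero _ (by exact_mod_cast hp)
  -- Division by zero gives `0` in `ℚ`, so the nonzero defect forces both invariants to be nonzero,
  -- that is, finite.
  have hef : (ramificationIndex K v : ℚ) * (inertiaDegree K v : ℚ) ≠ 0 := by
    intro h0
    rw [defect, h0, div_zero] at h
    exact hpm h.symm
  have he := left_ne_zero_of_mul hef
  have hf := right_ne_zero_of_mul hef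
  refine ⟨by exact_mod_cast he, by exact_mod_cast hf, ?_⟩
  rw [defect, div_eq_iff hef] at h
  exact_mod_cast h

theorem ndd_le_and_nddStar_le {v : AddValuation L (WithTop Γ)} (hidx : ramificationIndex K v ≠ 0)
    {S T : Finset L} (hS : Covers v {0}ᶜ (⊤ : IntermediateField K L) S)
    (hT : Covers v (algebraMap K L '' {0}ᶜ) (⊤ : IntermediateField K L) T) :
    ndd K v ≤ T.card ∧ nddStar K v ≤ S.card := by
  constructor
  · refine numDistances_le hidx ?_ hT.1 fun b hb => hT.2 b trivial hb
    rintro _ ⟨k, hk, rfl⟩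
    obtain ⟨γ, hγ⟩ := exists_coe_eq v ((_root_.map_ne_zero (algebraMap K L)).2 hk)
    exact ⟨γ, hγ, _, ⟨⟨γ, k, hγ⟩, rfl⟩, represents_coe v _⟩
  · refine numDistances_le hidx ?_ hS.1 fun b hb => hS.2 b trivial hb
    intro z hz
    obtain ⟨γ, hγ⟩ := exists_coe_eq v hz
    obtain ⟨q, hq⟩ := exists_represents hidx hγ
    exact ⟨γ, hγ, q, trivial, hq⟩

end PrimeLayers

end ValuedExt

theorem proposition3p4 {K L Γ : Type*} [Field K] [Field L] [Algebra K L] [FiniteDimensional K L]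
    [AddCommGroup Γ] [LinearOrder Γ] [IsOrderedAddMonoid Γ]
    (v : AddValuation L (WithTop Γ)) (huv : ValuedExt.IsUV K v)
    (p : ℕ) (hp : ExpChar (ValuedExt.residueField (ValuedExt.restrict K v)) p)
    (htower : ValuedExt.IsTowerOfDegree K L p)
    (m : ℕ) (hdefect : ValuedExt.defect K v = (p : ℚ) ^ m) :
    ValuedExt.ndd K v ≤ ((m * ValuedExt.ramificationIndex K v : ℕ) : ℕ∞) ∧
      ValuedExt.nddStar K v ≤ (m : ℕ∞) := by
  obtain ⟨n, E, h0, hn, hE⟩ := htower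
  have hp0 : p ≠ 0 := (expChar_pos (ValuedExt.residueField (ValuedExt.restrict K v)) p).ne'
  obtain ⟨hidx, hf, hfin⟩ := ValuedExt.finrank_eq_of_defect_eq hp0 hdefect
  have hpow := ValuedExt.finrank_eq_pow_of_tower h0 hn hE
  rcases hp with _ | ⟨hprime⟩
  -- For characteristic exponent `1` the tower is trivial: `L = K`, and there is nothing to
  -- represent.
  · rw [one_pow] at hpow
    have hempty : ∀ b : L, b ∉ ValuedExt.limitElements K v := by
      intro b hb
      have hbot : (⊥ : Subalgebra K L) = ⊤ := Subalgebra.bot_eq_top_of_finrank_eq_one hpow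
      have : b ∈ (⊥ : Subalgebra K L) := hbot ▸ trivial
      exact hb.1 (Algebra.mem_bot.1 this)
    have hcov : ∀ Z, ValuedExt.Covers v Z (⊤ : IntermediateField K L) ∅ :=
      fun Z => ⟨fun b hb => absurd hb (Finset.notMem_empty b), fun b _ hb => absurd hb (hempty b)⟩
    obtain ⟨h1, h2⟩ := ValuedExt.ndd_le_and_nddStar_le hidx (hcov _) (hcov _)
    exact ⟨h1.trans (by simp), h2.trans (by simp)⟩
  · have hpv : ∀ j : ℕ, 0 < j → j < p →
        (ValuedExt.valuationRing v).valuation (j : L) = 1 := by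
      intro j hj hjp
      refine ValuedExt.valuation_natCast_eq_one (K := K) v fun h => ?_
      rw [CharP.cast_eq_zero_iff (ValuedExt.residueField (ValuedExt.restrict K v)) p] at h
      exact (Nat.le_of_dvd hj h).not_gt hjp
    obtain ⟨t, S, T, hle, hSc, hS, hTc, hT⟩ :=
      ValuedExt.exists_covers_of_tower huv hprime hpv hidx h0 hE n le_rfl
    rw [hn] at hle hS hT
    rw [ValuedExt.valueGroup_restrict_top, ValuedExt.residueSubfield_top,
      ← ValuedExt.inertiaDegree_eq_relfinrank, ← hpow, hfin] at hle
    have hpos : 0 < ValuedExt.ramificationIndex K v * ValuedExt.inertiaDegree K v :=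
      Nat.pos_of_ne_zero (mul_ne_zero hidx hf)
    -- Cancel `e f` from `p ^ t * (e f) ≤ p ^ m * (e f)`.
    have htm : t ≤ m := (Nat.pow_le_pow_iff_right hprime.one_lt).1
      (Nat.le_of_mul_le_mul_right hle hpos)
    obtain ⟨h1, h2⟩ := ValuedExt.ndd_le_and_nddStar_le hidx hS hT
    exact ⟨h1.trans (by exact_mod_cast hTc.trans (Nat.mul_le_mul_right _ htm)),
      h2.trans (by exact_mod_cast hSc.trans htm)⟩
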